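/- Let $(\mathcal M,g)$ be a compact smooth Riemannian manifold (without boundary), and let $u:[0,\infty)\times\mathbb R^2\to\mathcal M$ be a smooth wave map (a smooth wave map with $T_{\max}=\infty$), i.e. $u$ is $C^\infty$ and in all local coordinates on $\mathcal M$ it solves $$\partial_t^2u^i-\Delta u^i=\sum_{k,\ell}\Gamma^i_{k\ell}(u)\left(\nabla_xu^k\cdot\nabla_xu^\ell-\partial_tu^k\,\partial_tu^\ell\right),$$ where $\Gamma^i_{k\ell}$ are the Christoffel symbols of $g$. Assume that $u$ has finite energy, $$\int_{\mathbb R^2}\left(|\nabla_xu(x,0)|_g^2+|\partial_tu(x,0)|_g^2\right)dx<\infty,$$ and that $u$ is quasi-equivariant: there is a smooth family $(\Phi_s)_{s\in\mathbb R/2\pi\mathbb Z}$ of isometries of $(\mathcal M,g)$ with $\Phi_0=\mathrm{Id}$ such that, in polar coordinates on $\mathbb R^2$, $u(r,\theta+s,t)=\Phi_s(u(r,\theta,t))$ for all $r>0$, all angles $s,\theta$, and all $t\ge0$. Then for every $\lambda\in(0,1)$, $$\int_{\lambda T<|x|<T-A}\left(|\nabla_xu(x,T)|_g^2+|\partial_tu(x,T)|_g^2\right)dx\longrightarrow0\qquad\text{as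 }T\to\infty\text{ and }A\to\infty\text{ subject to }A\le(1-\lambda)T.$$ -/

import Mathlib

open scoped Manifold ContDiff ENNReal

noncomputable section

/-- The space `ℝ^d` with its Euclidean norm. -/
abbrev Euc (d : ℕ) : Type := EuclideanSpace ℝ (Fin d)

/-- Points `(t, x)` of `(1+2)`-dimensional Minkowski space. Only the vector space structure and the
smooth structure of this product are used. -/
abbrev SpaceTime : Type := ℝ × Euc 2

/-- The closed future half-space `[0, ∞) × ℝ²`. -/
def futureHalf : Set SpaceTime := {z | 0 ≤ z.1}

/-- The unit vector in the time direction. -/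
def timeDir : SpaceTime := (1, 0)

/-- The unit vector in the `j`-th spatial direction. -/
def spaceDir (j : Fin 2) : SpaceTime := (0, EuclideanSpace.single j 1)

section Target

variable {n : ℕ} {M : Type*} [TopologicalSpace M] [ChartedSpace (Euc n) M]

/-- A smooth Riemannian metric on the `n`-dimensional manifold `M`. -/
abbrev SmoothMetric (n : ℕ) (M : Type*) [TopologicalSpace M] [ChartedSpace (Euc n) M]
    [IsManifold (𝓡 n) ∞ M] :=
  Bundle.ContMDiffRiemannianMetric (𝓡 n) ∞ (Euc n) (fun p : M => TangentSpace (𝓡 n) p)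

variable [IsManifold (𝓡 n) ∞ M]

/-- The coordinate vector field `∂_k` of the chart `φ`, at the point with coordinates `y`. -/
def coordVec (φ : OpenPartialHomeomorph M (Euc n)) (y : Euc n) (k : Fin n) :
    TangentSpace (𝓡 n) (φ.symm y) :=
  mfderiv (𝓡 n) (𝓡 n) φ.symm y (EuclideanSpace.single k (1 : ℝ) : Euc n)

/-- The matrix `(g_{kl})` of the metric in the chart `φ`, as a function of the coordinates. -/
def metricMatrix (g : SmoothMetric n M) (φ : OpenPartialHomeomorph M (Euc n)) (y : Euc n) :
    Matrix (Fin n) (Fin n) ℝ :=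
  Matrix.of fun k l => g.inner (φ.symm y) (coordVec φ y k) (coordVec φ y l)

/-- `∂_k g_{lm}` in the chart `φ`. -/
def metricDeriv (g : SmoothMetric n M) (φ : OpenPartialHomeomorph M (Euc n)) (y : Euc n)
    (k l m : Fin n) : ℝ :=
  fderiv ℝ (fun y' : Euc n => metricMatrix g φ y' l m) y (EuclideanSpace.single k 1)

/-- The Christoffel symbol
`Γ^i_{kl} = ½ ∑_m g^{im} (∂_k g_{ml} + ∂_l g_{mk} - ∂_m g_{kl})` in the chart `φ`. -/
def christoffel (g : SmoothMetric n M) (φ : OpenPartialHomeomorph M (Euc n)) (y : Euc n)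
    (i k l : Fin n) : ℝ :=
  (1 / 2) * ∑ m, (metricMatrix g φ y)⁻¹ i m *
    (metricDeriv g φ y k m l + metricDeriv g φ y l m k - metricDeriv g φ y m k l)

/-- The derivative of a real function on space-time in the direction `v`. -/
def dirDeriv (v : SpaceTime) (f : SpaceTime → ℝ) (z : SpaceTime) : ℝ :=
  fderiv ℝ f z v

/-- The wave operator `□ = ∂_t² - Δ`. -/
def waveOp (f : SpaceTime → ℝ) (z : SpaceTime) : ℝ :=
  dirDeriv timeDir (dirDeriv timeDir f) z - ∑ j, dirDeriv (spaceDir j) (dirDeriv (spaceDir j) f) z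

/-- The Minkowski product of gradients, of signature `(-,+,+)`:
`∇_x f · ∇_x h - ∂_t f ∂_t h`. -/
def nullForm (f h : SpaceTime → ℝ) (z : SpaceTime) : ℝ :=
  (∑ j, dirDeriv (spaceDir j) f z * dirDeriv (spaceDir j) h z)
    - dirDeriv timeDir f z * dirDeriv timeDir h z

/-- `u` is a smooth wave map from `[0, ∞) × ℝ²` to `(M, g)`: it is smooth up to the initial time,
and for `t > 0` it satisfies the wave map equation
`□ u^i = Γ^i_{kl}(u) (∇_x u^k · ∇_x u^l - ∂_t u^k ∂_t u^l)` in all local coordinates. -/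
structure IsGlobalWaveMap (g : SmoothMetric n M) (u : SpaceTime → M) : Prop where
  smooth : ContMDiffOn 𝓘(ℝ, SpaceTime) (𝓡 n) ∞ u futureHalf
  equation : ∀ z : SpaceTime, 0 < z.1 →
    ∀ φ ∈ IsManifold.maximalAtlas (𝓡 n) ∞ M, u z ∈ φ.source → ∀ i : Fin n,
      waveOp (fun w => φ (u w) i) z =
        ∑ k, ∑ l, christoffel g φ (φ (u z)) i k l *
          nullForm (fun w => φ (u w) k) (fun w => φ (u w) l) z

/-- The derivative of `u` at `z` in the direction `v`, a tangent vector to `M`. At `t = 0` the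
derivative is one-sided in time; for `t > 0` it is the ordinary derivative. -/
def mapDeriv (u : SpaceTime → M) (z v : SpaceTime) : TangentSpace (𝓡 n) (u z) :=
  mfderivWithin 𝓘(ℝ, SpaceTime) (𝓡 n) u futureHalf z v

/-- `|∇_x u|_g² + |∂_t u|_g²`. -/
def energyDensity (g : SmoothMetric n M) (u : SpaceTime → M) (z : SpaceTime) : ℝ :=
  (∑ j, g.inner (u z) (mapDeriv u z (spaceDir j)) (mapDeriv u z (spaceDir j)))
    + g.inner (u z) (mapDeriv u z timeDir) (mapDeriv u z timeDir)

/-- The energy of `u` at time `t` in the region `A ⊆ ℝ²`. -/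
def energyOn (g : SmoothMetric n M) (u : SpaceTime → M) (t : ℝ) (A : Set (Euc 2)) : ℝ≥0∞ :=
  ∫⁻ x in A, ENNReal.ofReal (energyDensity g u (t, x))

/-- The initial data `(u, ∂_t u)` at `t = 0` have finite energy. -/
def FiniteEnergy (g : SmoothMetric n M) (u : SpaceTime → M) : Prop :=
  energyOn g u 0 Set.univ < ⊤

/-- A diffeomorphism of `M` which is an isometry of the Riemannian metric `g`. -/
def IsRiemannianIsometry (g : SmoothMetric n M) (Φ : Diffeomorph (𝓡 n) (𝓡 n) M M ∞) : Prop :=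
  ∀ (p : M) (v w : TangentSpace (𝓡 n) p),
    g.inner (Φ p) (mfderiv (𝓡 n) (𝓡 n) Φ p v) (mfderiv (𝓡 n) (𝓡 n) Φ p w) = g.inner p v w

/-- The point of `ℝ²` with polar coordinates `(r, θ)`. -/
def polarPoint (r θ : ℝ) : Euc 2 := !₂[r * Real.cos θ, r * Real.sin θ]

/-- `u` is quasi-equivariant: there is a smooth family `(Φ_s)`, `s ∈ ℝ / 2πℤ`, of isometries of
`(M, g)`, with `Φ_0 = id`, such that `u(t, r, θ + s) = Φ_s (u(t, r, θ))`. -/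
def IsQuasiEquivariant (g : SmoothMetric n M) (u : SpaceTime → M) : Prop :=
  ∃ Φ : ℝ → Diffeomorph (𝓡 n) (𝓡 n) M M ∞,
    ContMDiff (𝓘(ℝ, ℝ).prod (𝓡 n)) (𝓡 n) ∞ (fun q : ℝ × M => Φ q.1 q.2) ∧
    (∀ s, IsRiemannianIsometry g (Φ s)) ∧
    (∀ s p, Φ (s + 2 * Real.pi) p = Φ s p) ∧
    (∀ p, Φ 0 p = p) ∧
    ∀ t r θ s : ℝ, 0 ≤ t → 0 < r →
      u (t, polarPoint r (θ + s)) = Φ s (u (t, polarPoint r θ))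

end Target

end

/-! Put `e = ½(|∂_t u|² + |∂_r u|² + r⁻²|∂_θ u|²)` and `m = ⟨∂_t u, ∂_r u⟩`. Quasi-equivariance
makes both radial. The stress-energy tensor is divergence free; its time component is `∂_t(re) =
∂_r(rm)`, and its radial component expresses the defect `∂_t(rm) - ∂_r(re)` through first
derivatives of `u` and the `r`-derivative of `|∂_θ u|²`. The defect has to be bounded by `√(e² -
m²)`, the geometric mean of `e + m` and `e - m`. The critical term is that `r`-derivative. Here `∂_θ
u = X(u)`, where the field `X` generates `Φ_s`, so `|∂_θ u|² = |X|²(u)`, and compactness of the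
target gives `|∂_r |∂_θ u|²| ≤ C |∂_r u| |∂_θ u|` (`exists_dirDeriv_angular_le`,
`ray_momentum_defect_le`).

The rest is an argument in the null coordinates `ξ = t - r`, `η = t + r`. The energy `Ψ(ξ, η)` of
the disc of radius `r` at time `t` is a potential: `p = ∂_η Ψ` and `q = -∂_ξ Ψ` equal `r(e ± m)/2 ≥
0`, and `|∂_η q| ≤ C √(pq)/(η - ξ)`. The limit `V(ξ)` of `Ψ(ξ, η)` as `η → ∞` is nonincreasing and
nonnegative. Hence for some `ξ₀` it varies little beyond `ξ₀`, and the flux through `{ξ₀} × [N, ∞)`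
is small for large `N`. A Gronwall estimate (`null_flux_gronwall`) transports this smallness from
`ξ₀` to `ξ₁ = (1 - λ)T` with `N = (1 + λ)T`; the growth factor is the exponential of a constant
times `(ξ₁ - ξ₀)/N`, hence bounded in `T`. The energy of the annulus is `Ψ(A, 2T - A) - Ψ(ξ₁, N)`,
at most the small variation `V(ξ₀) - V(ξ₁)` plus the small flux through `{ξ₁} × [N, ∞)`
(`null_potential_vanishing`). -/

/-! ### Parameter integrals and the Gronwall estimate for null fluxes -/

section RealAnalysis

open Set Filter Topology MeasureTheory

/-- Differentiation of an integral over a compact interval with respect to a parameter, for an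
integrand whose derivative in the parameter is jointly continuous. -/
theorem hasDerivAt_intervalIntegral_param {F F' : ℝ → ℝ → ℝ} {a b x₀ ε : ℝ} (hε : 0 < ε)
    (hF : ∀ x ∈ Metric.closedBall x₀ ε, ContinuousOn (F x) (uIcc a b))
    (hd : ∀ x ∈ Metric.closedBall x₀ ε, ∀ s ∈ uIcc a b, HasDerivAt (fun y => F y s) (F' x s) x)
    (hF' : ContinuousOn (fun z : ℝ × ℝ => F' z.1 z.2) (Metric.closedBall x₀ ε ×ˢ uIcc a b)) :
    HasDerivAt (fun x => ∫ s in a..b, F x s) (∫ s in a..b, F' x₀ s) x₀ := by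
  obtain ⟨K, hK⟩ := ((isCompact_closedBall x₀ ε).prod isCompact_uIcc).exists_bound_of_continuousOn
    hF'
  have hx₀ : x₀ ∈ Metric.closedBall x₀ ε := Metric.mem_closedBall_self hε.le
  have hsub : uIoc a b ⊆ uIcc a b := uIoc_subset_uIcc
  refine (intervalIntegral.hasDerivAt_integral_of_dominated_loc_of_deriv_le (bound := fun _ => K)
    (Metric.closedBall_mem_nhds x₀ hε) ?_ (hF x₀ hx₀).intervalIntegrable ?_ ?_ (by simp) ?_).2
  · filter_upwards [Metric.closedBall_mem_nhds x₀ hε] with x hx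
    exact ((hF x hx).mono hsub).aestronglyMeasurable measurableSet_uIoc
  · refine ContinuousOn.aestronglyMeasurable (ContinuousOn.mono ?_ hsub) measurableSet_uIoc
    exact hF'.comp (f := fun s => (x₀, s)) (by fun_prop) fun s hs => ⟨hx₀, hs⟩
  · exact ae_of_all _ fun s hs x hx => hK (x, s) ⟨hx, hsub hs⟩
  · exact ae_of_all _ fun s hs x hx => hd x hx s (hsub hs)

theorem continuousOn_intervalIntegral_param {F : ℝ → ℝ → ℝ} {a b : ℝ} {K : Set ℝ}
    (hK : IsCompact K) (hF : ContinuousOn (fun z : ℝ × ℝ => F z.1 z.2) (K ×ˢ uIcc a b)) :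
    ContinuousOn (fun x => ∫ s in a..b, F x s) K := by
  obtain ⟨B, hB⟩ := (hK.prod isCompact_uIcc).exists_bound_of_continuousOn hF
  have hsub : uIoc a b ⊆ uIcc a b := uIoc_subset_uIcc
  intro x₀ hx₀
  refine intervalIntegral.continuousWithinAt_of_dominated_interval (bound := fun _ => B)
    ?_ ?_ (by simp) ?_
  · filter_upwards [self_mem_nhdsWithin] with x hx
    refine ContinuousOn.aestronglyMeasurable (ContinuousOn.mono ?_ hsub) measurableSet_uIoc
    exact hF.comp (f := fun s => (x, s)) (by fun_prop) fun s hs => ⟨hx, hs⟩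
  · filter_upwards [self_mem_nhdsWithin] with x hx
    exact ae_of_all _ fun s hs => hB (x, s) ⟨hx, hsub hs⟩
  · refine ae_of_all _ fun s hs => ?_
    exact (hF.comp (f := fun x => (x, s)) (by fun_prop) fun x hx => ⟨hx, hsub hs⟩) x₀ hx₀

theorem monotoneOn_Icc_of_hasDerivAt {f f' : ℝ → ℝ} {a b : ℝ} (hf : ContinuousOn f (Icc a b))
    (hd : ∀ x ∈ Ioo a b, HasDerivAt f (f' x) x) (h0 : ∀ x ∈ Ioo a b, 0 ≤ f' x) :
    MonotoneOn f (Icc a b) := by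
  refine monotoneOn_of_deriv_nonneg (convex_Icc a b) hf ?_ ?_
  · rw [interior_Icc]
    exact fun x hx => (hd x hx).differentiableAt.differentiableWithinAt
  · rw [interior_Icc]
    exact fun x hx => (hd x hx).deriv ▸ h0 x hx

theorem antitoneOn_Icc_of_hasDerivAt {f f' : ℝ → ℝ} {a b : ℝ} (hf : ContinuousOn f (Icc a b))
    (hd : ∀ x ∈ Ioo a b, HasDerivAt f (f' x) x) (h0 : ∀ x ∈ Ioo a b, f' x ≤ 0) :
    AntitoneOn f (Icc a b) := by
  refine antitoneOn_of_deriv_nonpos (convex_Icc a b) hf ?_ ?_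
  · rw [interior_Icc]
    exact fun x hx => (hd x hx).differentiableAt.differentiableWithinAt
  · rw [interior_Icc]
    exact fun x hx => (hd x hx).deriv ▸ h0 x hx

/-- The domain `0 < ξ < η` of null coordinates. -/
def nullDomain : Set (ℝ × ℝ) := {z | 0 < z.1 ∧ z.1 < z.2}

/-- A Gronwall estimate for the energy flux through the null segments `{ξ} × [N, N']`, where `Ψ` is
a potential whose null derivatives `p = ∂_η Ψ`, `q = -∂_ξ Ψ` are nonnegative and
`|∂_η q| ≤ C √(p q) / η`. -/
theorem null_flux_gronwall {Ψ p q l : ℝ → ℝ → ℝ} {C N N' ξ₀ ξ₁ δ : ℝ}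
    (hξ₀ : 0 < ξ₀) (hξ : ξ₀ ≤ ξ₁) (hN : ξ₁ < N) (hN' : N ≤ N')
    (hΨc : ContinuousOn (fun z : ℝ × ℝ => Ψ z.1 z.2) nullDomain)
    (hqc : ContinuousOn (fun z : ℝ × ℝ => q z.1 z.2) nullDomain)
    (hΨξ : ∀ ξ η, 0 < ξ → ξ < η → HasDerivAt (fun x => Ψ x η) (-q ξ η) ξ)
    (hΨη : ∀ ξ η, 0 < ξ → ξ < η → HasDerivAt (fun y => Ψ ξ y) (p ξ η) η)
    (hqη : ∀ ξ η, 0 < ξ → ξ < η → HasDerivAt (fun y => q ξ y) (-l ξ η) η)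
    (hp : ∀ ξ η, 0 < ξ → ξ < η → 0 ≤ p ξ η) (hq : ∀ ξ η, 0 < ξ → ξ < η → 0 ≤ q ξ η)
    (hl : ∀ ξ η, ξ₀ ≤ ξ → ξ ≤ ξ₁ → N ≤ η → |l ξ η| ≤ C / η * √(p ξ η * q ξ η))
    (hδ : ∀ ξ, ξ₀ ≤ ξ → ξ ≤ ξ₁ → Ψ ξ₀ N' - Ψ ξ N' ≤ δ) :
    Ψ ξ₁ N' - Ψ ξ₁ N ≤
      (2 * (Ψ ξ₀ N' - Ψ ξ₀ N) + δ) * Real.exp (C ^ 2 / N * (ξ₁ - ξ₀)) := by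
  have hNpos : 0 < N := by linarith
  have hdom : ∀ ξ ∈ Icc ξ₀ ξ₁, ∀ η ∈ Icc N N', (ξ, η) ∈ nullDomain := fun ξ hξ' η hη =>
    ⟨hξ₀.trans_le hξ'.1, hξ'.2.trans_lt (hN.trans_le hη.1)⟩
  have hu : uIcc N N' = Icc N N' := uIcc_of_le hN'
  have hΨ1 : ∀ η ∈ Icc N N', ContinuousOn (fun ξ => Ψ ξ η) (Icc ξ₀ ξ₁) := fun η hη =>
    hΨc.comp (f := fun ξ => (ξ, η)) (by fun_prop) fun ξ hξ' => hdom ξ hξ' η hη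
  have hmono : ∀ ξ ∈ Icc ξ₀ ξ₁, MonotoneOn (fun η => Ψ ξ η) (Icc N N') := by
    intro ξ hξ'
    refine monotoneOn_Icc_of_hasDerivAt (f' := fun η => p ξ η) ?_ ?_ ?_
    · exact hΨc.comp (f := fun η => (ξ, η)) (by fun_prop) fun η hη => hdom ξ hξ' η hη
    · exact fun η hη => hΨη ξ η (hdom ξ hξ' η (Ioo_subset_Icc_self hη)).1
        (hdom ξ hξ' η (Ioo_subset_Icc_self hη)).2
    · exact fun η hη => hp ξ η (hdom ξ hξ' η (Ioo_subset_Icc_self hη)).1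
        (hdom ξ hξ' η (Ioo_subset_Icc_self hη)).2
  have hNm : N ∈ Icc N N' := ⟨le_rfl, hN'⟩
  have hNm' : N' ∈ Icc N N' := ⟨hN', le_rfl⟩
  set Q : ℝ → ℝ := fun ξ => Ψ ξ N' - Ψ ξ N with hQdef
  -- `S` is a corrector: `-S'` is the integral of `s⁻² q`, exactly the term that Young's inequality
  -- leaves over when `Q' = q(ξ, N) - q(ξ, N')` is estimated.
  set S : ℝ → ℝ := fun ξ => ∫ s in N..N', s⁻¹ ^ 2 * Ψ ξ s with hSdef
  have hQ0 : ∀ ξ ∈ Icc ξ₀ ξ₁, 0 ≤ Q ξ := fun ξ hξ' =>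
    sub_nonneg.2 (hmono ξ hξ' hNm hNm' hN')
  have hinv : ContinuousOn (fun s : ℝ => s⁻¹ ^ 2) (Icc N N') :=
    (continuousOn_inv₀.mono fun s hs => (hNpos.trans_le hs.1).ne').pow 2
  have hSc : ContinuousOn S (Icc ξ₀ ξ₁) := by
    have : ContinuousOn (fun z : ℝ × ℝ => z.2⁻¹ ^ 2 * Ψ z.1 z.2) (Icc ξ₀ ξ₁ ×ˢ uIcc N N') := by
      rw [hu]
      refine ContinuousOn.mul (hinv.comp continuousOn_snd fun z hz => hz.2)
        (hΨc.mono fun z hz => hdom z.1 hz.1 z.2 hz.2)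
    exact continuousOn_intervalIntegral_param isCompact_Icc this
  have hSd : ∀ ξ ∈ Ioo ξ₀ ξ₁, HasDerivAt S (∫ s in N..N', s⁻¹ ^ 2 * -q ξ s) ξ := by
    intro ξ hξ'
    obtain ⟨ε, hε, hball⟩ := Metric.nhds_basis_closedBall.mem_iff.1 (Ioo_mem_nhds hξ'.1 hξ'.2)
    have hball' : ∀ x ∈ Metric.closedBall ξ ε, x ∈ Icc ξ₀ ξ₁ := fun x hx =>
      Ioo_subset_Icc_self (hball hx)
    refine hasDerivAt_intervalIntegral_param (F' := fun ξ s => s⁻¹ ^ 2 * -q ξ s) hε ?_ ?_ ?_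
    · intro x hx
      rw [hu]
      exact hinv.mul (hΨc.comp (f := fun η => (x, η)) (by fun_prop)
        fun η hη => hdom x (hball' x hx) η hη)
    · intro x hx s hs
      rw [hu] at hs
      exact (hΨξ x s (hdom x (hball' x hx) s hs).1 (hdom x (hball' x hx) s hs).2).const_mul _
    · rw [hu]
      exact (hinv.comp continuousOn_snd fun z hz => hz.2).mul
        (hqc.mono fun z hz => hdom z.1 (hball' z.1 hz.1) z.2 hz.2).neg
  have hkey : ∀ ξ ∈ Icc ξ₀ ξ₁,
      q ξ N - q ξ N' ≤ C ^ 2 / (2 * N) * Q ξ + N / 2 * ∫ s in N..N', s⁻¹ ^ 2 * q ξ s := by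
    intro ξ hξ'
    have hqcξ : ContinuousOn (fun s => q ξ s) (Icc N N') :=
      hqc.comp (f := fun η => (ξ, η)) (by fun_prop) fun η hη => hdom ξ hξ' η hη
    have hcont : ContinuousOn (fun s => s⁻¹ ^ 2 * q ξ s) (Icc N N') := hinv.mul hqcξ
    have hΨcξ : ContinuousOn (fun s => Ψ ξ s) (Icc N N') :=
      hΨc.comp (f := fun η => (ξ, η)) (by fun_prop) fun η hη => hdom ξ hξ' η hη
    -- Monotonicity of one combination replaces the integration of `l` over `[N, N']`; no continuity
    -- of `l` is needed.
    have hm := monotoneOn_Icc_of_hasDerivAt (a := N) (b := N')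
      (f := fun η => C ^ 2 / (2 * N) * Ψ ξ η + N / 2 * (∫ s in N..η, s⁻¹ ^ 2 * q ξ s) + q ξ η)
      (f' := fun η => C ^ 2 / (2 * N) * p ξ η + N / 2 * (η⁻¹ ^ 2 * q ξ η) + -l ξ η) ?_ ?_ ?_
    · have := hm hNm hNm' hN'
      simp only [intervalIntegral.integral_same] at this
      simp only [hQdef]
      nlinarith
    · refine ((hΨcξ.const_mul _).add (ContinuousOn.const_mul ?_ _)).add hqcξ
      have := intervalIntegral.continuousOn_primitive_interval' (μ := volume) (a := N)
        (b₁ := N) (b₂ := N') (f := fun s => s⁻¹ ^ 2 * q ξ s)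
        (by rw [← hu] at hcont; exact hcont.intervalIntegrable) left_mem_uIcc
      rwa [hu] at this
    · intro η hη
      have hη' := Ioo_subset_Icc_self hη
      refine (((hΨη ξ η (hdom ξ hξ' η hη').1 (hdom ξ hξ' η hη').2).const_mul _).add
        (HasDerivAt.const_mul _ ?_)).add (hqη ξ η (hdom ξ hξ' η hη').1 (hdom ξ hξ' η hη').2)
      refine intervalIntegral.integral_hasDerivAt_right ?_ ?_ ?_
      · refine ContinuousOn.intervalIntegrable ?_
        rw [uIcc_of_le hη.1.le]
        exact hcont.mono (Icc_subset_Icc_right hη.2.le)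
      · exact hcont.stronglyMeasurableAtFilter_nhdsWithin measurableSet_Icc η |>.filter_mono
          (by rw [nhdsWithin_eq_nhds.2 (Icc_mem_nhds hη.1 hη.2)])
      · exact hcont.continuousAt (Icc_mem_nhds hη.1 hη.2)
    · intro η hη
      have hη' := Ioo_subset_Icc_self hη
      have h1 := (le_abs_self _).trans (hl ξ η hξ'.1 hξ'.2 hη.1.le)
      have hp' := hp ξ η (hdom ξ hξ' η hη').1 (hdom ξ hξ' η hη').2
      have hq' := hq ξ η (hdom ξ hξ' η hη').1 (hdom ξ hξ' η hη').2
      rw [Real.sqrt_mul hp'] at h1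
      have hsp := Real.sq_sqrt hp'
      have hsq := Real.sq_sqrt hq'
      set a := √(p ξ η)
      set b := √(q ξ η)
      rw [← hsp, ← hsq]
      -- Young's inequality as a completed square, weighted so that the `p` term integrates to a
      -- multiple of `Q` and the `q` term to a multiple of `-S'`.
      have h2 : C ^ 2 / (2 * N) * a ^ 2 + N / 2 * (η⁻¹ ^ 2 * b ^ 2) - C / η * (a * b)
          = (C * a - N * η⁻¹ * b) ^ 2 / (2 * N) := by
        have : η ≠ 0 := (hNpos.trans hη.1).ne'
        field_simp
        ring
      have h3 : 0 ≤ (C * a - N * η⁻¹ * b) ^ 2 / (2 * N) := by positivity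
      linarith
  -- For `s` in `[N, N']`, monotonicity in `η` gives `Ψ ξ₀ s - Ψ ξ s ≤ Ψ ξ₀ N' - Ψ ξ N ≤ δ + Q ξ`,
  -- and `s⁻²` has integral at most `1 / N`.
  have hS : ∀ ξ ∈ Icc ξ₀ ξ₁, S ξ₀ - S ξ ≤ (δ + Q ξ) / N := by
    intro ξ hξ'
    have h0m : ξ₀ ∈ Icc ξ₀ ξ₁ := ⟨le_rfl, hξ⟩
    have hi : ∀ x ∈ Icc ξ₀ ξ₁, IntervalIntegrable (fun s => s⁻¹ ^ 2 * Ψ x s) volume N N' := by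
      intro x hx
      refine ContinuousOn.intervalIntegrable ?_
      rw [hu]
      exact hinv.mul (hΨc.comp (f := fun η => (x, η)) (by fun_prop) fun η hη => hdom x hx η hη)
    have hi2 : IntervalIntegrable (fun s : ℝ => s⁻¹ ^ 2) volume N N' := by
      refine ContinuousOn.intervalIntegrable ?_
      rwa [hu]
    rw [hSdef]
    simp only
    rw [← intervalIntegral.integral_sub (hi _ h0m) (hi _ hξ')]
    have h1 : ∫ s in N..N', (s⁻¹ ^ 2 * Ψ ξ₀ s - s⁻¹ ^ 2 * Ψ ξ s)
        ≤ ∫ s in N..N', s⁻¹ ^ 2 * (δ + Q ξ) := by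
      refine intervalIntegral.integral_mono_on hN' ((hi _ h0m).sub (hi _ hξ'))
        (hi2.mul_const _) ?_
      intro s hs
      rw [← mul_sub]
      refine mul_le_mul_of_nonneg_left ?_ (by positivity)
      have e1 := hmono ξ₀ h0m hs hNm' hs.2
      have e2 := hmono ξ hξ' hNm hs hs.1
      have e3 := hδ ξ hξ'.1 hξ'.2
      simp only [hQdef] at *
      linarith
    refine h1.trans ?_
    rw [intervalIntegral.integral_mul_const]
    have h2 : ∫ s in N..N', s⁻¹ ^ 2 = N⁻¹ - N'⁻¹ := by
      have hd : ∀ x ∈ uIcc N N', HasDerivAt (fun s : ℝ => -s⁻¹) (x⁻¹ ^ 2) x := by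
        intro x hx
        rw [hu] at hx
        have hx0 : x ≠ 0 := (hNpos.trans_le hx.1).ne'
        have := (hasDerivAt_inv hx0).neg
        convert! this using 1
        simp
      rw [intervalIntegral.integral_eq_sub_of_hasDerivAt hd hi2]
      ring
    rw [h2]
    have h3 : 0 ≤ δ + Q ξ := by
      have := hδ ξ₀ le_rfl hξ
      have := hQ0 ξ hξ'
      linarith
    have h4 : 0 ≤ N'⁻¹ := by
      have : 0 < N' := hNpos.trans_le hN'
      positivity
    rw [div_eq_inv_mul]
    exact mul_le_mul_of_nonneg_right (by linarith) h3
  -- The corrector costs at most `(δ + Q) / 2`, so half of `Q` survives: doubling and adding `δ`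
  -- gives `Q ≤ Y`. By `hkey`, `Y' ≤ (C² / N) Q ≤ (C² / N) Y`, which closes the Gronwall loop.
  set Y : ℝ → ℝ := fun ξ => 2 * (Q ξ + N / 2 * (S ξ - S ξ₀)) + δ with hYdef
  have hQY : ∀ ξ ∈ Icc ξ₀ ξ₁, Q ξ ≤ Y ξ := by
    intro ξ hξ'
    have h1 := hS ξ hξ'
    rw [le_div_iff₀ hNpos] at h1
    simp only [hYdef]
    nlinarith
  have hQc : ContinuousOn Q (Icc ξ₀ ξ₁) := (hΨ1 N' hNm').sub (hΨ1 N hNm)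
  have hYc : ContinuousOn Y (Icc ξ₀ ξ₁) :=
    ((hQc.add ((hSc.sub continuousOn_const).const_mul _)).const_mul 2).add continuousOn_const
  have hanti := antitoneOn_Icc_of_hasDerivAt (a := ξ₀) (b := ξ₁)
    (f := fun ξ => Y ξ * Real.exp (-(C ^ 2 / N * (ξ - ξ₀))))
    (f' := fun ξ => (2 * ((-q ξ N' - -q ξ N) + N / 2 * ∫ s in N..N', s⁻¹ ^ 2 * -q ξ s)) *
      Real.exp (-(C ^ 2 / N * (ξ - ξ₀))) + Y ξ * (Real.exp (-(C ^ 2 / N * (ξ - ξ₀))) *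
        (-(C ^ 2 / N * 1)))) ?_ ?_ ?_
  · have h := hanti ⟨le_rfl, hξ⟩ ⟨hξ, le_rfl⟩ hξ
    simp only [sub_self, mul_zero, neg_zero, Real.exp_zero, mul_one] at h
    have hY0 : Y ξ₀ = 2 * (Ψ ξ₀ N' - Ψ ξ₀ N) + δ := by simp [hYdef, hQdef]
    have h1 := hQY ξ₁ ⟨hξ, le_rfl⟩
    rw [Real.exp_neg, ← div_eq_mul_inv, div_le_iff₀ (Real.exp_pos _), hY0] at h
    exact h1.trans h
  · exact hYc.mul (by fun_prop)
  · intro ξ hξ'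
    have hd := fun η hη => hΨξ ξ η (hdom ξ (Ioo_subset_Icc_self hξ') η hη).1
      (hdom ξ (Ioo_subset_Icc_self hξ') η hη).2
    refine HasDerivAt.mul ?_ ?_
    · exact ((((hd N' hNm').sub (hd N hNm)).add
        (((hSd ξ hξ').sub_const _).const_mul _)).const_mul 2).add_const _
    · exact ((((hasDerivAt_id ξ).sub_const ξ₀).const_mul _).neg).exp
  · intro ξ hξ'
    have hk := hkey ξ (Ioo_subset_Icc_self hξ')
    have hY := hQY ξ (Ioo_subset_Icc_self hξ')
    have he := Real.exp_pos (-(C ^ 2 / N * (ξ - ξ₀)))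
    simp only [mul_neg, intervalIntegral.integral_neg]
    have h1 : C ^ 2 / (2 * N) * Q ξ ≤ C ^ 2 / (2 * N) * Y ξ :=
      mul_le_mul_of_nonneg_left hY (by positivity)
    have h2 : C ^ 2 / (2 * N) * Y ξ = C ^ 2 / N * Y ξ / 2 := by
      field_simp
    have h3 : 2 * ((-q ξ N' - -q ξ N) + -(N / 2 * ∫ s in N..N', s⁻¹ ^ 2 * q ξ s)) -
      C ^ 2 / N * Y ξ ≤ 0 := by linarith
    have h4 := mul_nonpos_of_nonpos_of_nonneg h3 he.le
    linarith

end RealAnalysis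

/-! ### Smallness of the potential difference far out in null coordinates -/

section RealAnalysis

open Set Filter Topology MeasureTheory

/-- The limits `V ξ` of `Ψ ξ` at infinity are nonincreasing in `ξ` and bounded below, so their
variation beyond some `ξ₀` is small. This controls `Ψ A η` by `V ξ₀`, hence by `V ξ₁`. What remains
is the flux through `{ξ₁} × [κ ξ₁, ∞)`, which `null_flux_gronwall` bounds by the small one on
`{ξ₀}`, with a factor that does not depend on `ξ₁`. -/
theorem null_potential_vanishing {Ψ p q l : ℝ → ℝ → ℝ} {C E κ : ℝ} (hC : 0 ≤ C) (hκ : 1 < κ)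
    (hΨc : ContinuousOn (fun z : ℝ × ℝ => Ψ z.1 z.2) nullDomain)
    (hqc : ContinuousOn (fun z : ℝ × ℝ => q z.1 z.2) nullDomain)
    (hΨξ : ∀ ξ η, 0 < ξ → ξ < η → HasDerivAt (fun x => Ψ x η) (-q ξ η) ξ)
    (hΨη : ∀ ξ η, 0 < ξ → ξ < η → HasDerivAt (fun y => Ψ ξ y) (p ξ η) η)
    (hqη : ∀ ξ η, 0 < ξ → ξ < η → HasDerivAt (fun y => q ξ y) (-l ξ η) η)
    (hp : ∀ ξ η, 0 < ξ → ξ < η → 0 ≤ p ξ η) (hq : ∀ ξ η, 0 < ξ → ξ < η → 0 ≤ q ξ η)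
    (hl : ∀ ξ η, 0 < ξ → ξ < η → |l ξ η| ≤ C / (η - ξ) * √(p ξ η * q ξ η))
    (hΨ0 : ∀ ξ η, 0 < ξ → ξ < η → 0 ≤ Ψ ξ η) (hΨE : ∀ ξ η, 0 < ξ → ξ < η → Ψ ξ η ≤ E)
    {ε : ℝ} (hε : 0 < ε) :
    ∃ ξ₀ > 0, ∃ X > 0, ∀ ξ₁ ≥ X, ∀ A, ξ₀ ≤ A → ∀ η > A, Ψ A η - Ψ ξ₁ (κ * ξ₁) ≤ ε := by
  have hmono : ∀ ξ, 0 < ξ → ∀ η η', ξ < η → η ≤ η' → Ψ ξ η ≤ Ψ ξ η' := by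
    intro ξ hξ η η' h1 h2
    refine monotoneOn_Icc_of_hasDerivAt (f := fun η => Ψ ξ η) (f' := fun η => p ξ η)
      (a := η) (b := η') ?_ ?_ ?_ ⟨le_rfl, h2⟩ ⟨h2, le_rfl⟩ h2
    · exact hΨc.comp (f := fun η => (ξ, η)) (by fun_prop) fun η hη => ⟨hξ, h1.trans_le hη.1⟩
    · exact fun y hy => hΨη ξ y hξ (h1.trans hy.1)
    · exact fun y hy => hp ξ y hξ (h1.trans hy.1)
  have hanti : ∀ ξ ξ' η, 0 < ξ → ξ ≤ ξ' → ξ' < η → Ψ ξ' η ≤ Ψ ξ η := by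
    intro ξ ξ' η hξ h1 h2
    refine antitoneOn_Icc_of_hasDerivAt (f := fun ξ => Ψ ξ η) (f' := fun ξ => -q ξ η)
      (a := ξ) (b := ξ') ?_ ?_ ?_ ⟨le_rfl, h1⟩ ⟨h1, le_rfl⟩ h1
    · exact hΨc.comp (f := fun ξ => (ξ, η)) (by fun_prop)
        fun x hx => ⟨hξ.trans_le hx.1, hx.2.trans_lt h2⟩
    · exact fun x hx => hΨξ x η (hξ.trans hx.1) (hx.2.trans h2)
    · exact fun x hx => neg_nonpos.2 (hq x η (hξ.trans hx.1) (hx.2.trans h2))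
  -- Since `Ψ ξ` is nondecreasing in `η`, this supremum is its limit at infinity.
  set V : ℝ → ℝ := fun ξ => sSup (Ψ ξ '' Ioi ξ) with hVdef
  have hbdd : ∀ ξ, 0 < ξ → BddAbove (Ψ ξ '' Ioi ξ) := fun ξ hξ =>
    ⟨E, by rintro _ ⟨η, hη, rfl⟩; exact hΨE ξ η hξ hη⟩
  have hne : ∀ ξ, (Ψ ξ '' Ioi ξ).Nonempty := fun ξ => nonempty_Ioi.image _
  have hle : ∀ ξ η, 0 < ξ → ξ < η → Ψ ξ η ≤ V ξ := fun ξ η hξ hη =>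
    le_csSup (hbdd ξ hξ) ⟨η, hη, rfl⟩
  have hV0 : ∀ ξ, 0 < ξ → 0 ≤ V ξ := fun ξ hξ =>
    (hΨ0 ξ (ξ + 1) hξ (by linarith)).trans (hle ξ (ξ + 1) hξ (by linarith))
  have happ : ∀ ξ, 0 < ξ → ∀ c > 0, ∃ N₀ > ξ, ∀ η ≥ N₀, V ξ - c ≤ Ψ ξ η := by
    intro ξ hξ c hc
    obtain ⟨_, ⟨η₀, hη₀, rfl⟩, h⟩ := exists_lt_of_lt_csSup (hne ξ) (sub_lt_self (V ξ) hc)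
    exact ⟨η₀, hη₀, fun η hη => h.le.trans (hmono ξ hξ η₀ η hη₀ hη)⟩
  have hVanti : ∀ ξ ξ', 0 < ξ → ξ ≤ ξ' → V ξ' ≤ V ξ := by
    intro ξ ξ' hξ h
    refine csSup_le (hne ξ') ?_
    rintro _ ⟨η, hη, rfl⟩
    exact (hanti ξ ξ' η hξ h hη).trans (hle ξ η hξ (h.trans_lt hη))
  -- For `η ≥ κ ξ₁ ≥ κ ξ` one has `η - ξ ≥ (1 - κ⁻¹) η`, so `C / (η - ξ) ≤ D / η`, the form required
  -- by the Gronwall lemma.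
  set D := C / (1 - κ⁻¹) with hD
  have hκ1 : 0 < 1 - κ⁻¹ := sub_pos.2 (inv_lt_one_of_one_lt₀ hκ)
  -- The final bound is `4 c exp (D²)` for the transported flux plus `2 c`: one `c` for the
  -- variation of `V` and one for stopping at `N'`.
  set c := ε / (2 + 4 * Real.exp (D ^ 2)) with hc
  have hcpos : 0 < c := by positivity
  obtain ⟨_, ⟨ξ₀, hξ₀, rfl⟩, hinf⟩ := exists_lt_of_csInf_lt (nonempty_Ioi.image V)
    (lt_add_of_pos_right (sInf (V '' Ioi 0)) hcpos)
  have hξ₀' : 0 < ξ₀ := hξ₀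
  have htail : ∀ ξ, 0 < ξ → V ξ₀ - V ξ ≤ c := by
    intro ξ hξ
    have : sInf (V '' Ioi 0) ≤ V ξ :=
      csInf_le ⟨0, by rintro _ ⟨x, hx, rfl⟩; exact hV0 x hx⟩ ⟨ξ, hξ, rfl⟩
    linarith
  obtain ⟨N₀, hN₀, hN₀'⟩ := happ ξ₀ hξ₀' c hcpos
  refine ⟨ξ₀, hξ₀', max ξ₀ N₀, lt_max_of_lt_left hξ₀', ?_⟩
  intro ξ₁ hξ₁ A hA η hη
  have h1 : ξ₀ ≤ ξ₁ := (le_max_left _ _).trans hξ₁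
  have hξ₁pos : 0 < ξ₁ := hξ₀'.trans_le h1
  have h2 : N₀ ≤ κ * ξ₁ := ((le_max_right _ _).trans hξ₁).trans (by nlinarith)
  have h3 : ξ₁ < κ * ξ₁ := by nlinarith
  obtain ⟨N₁, -, hN₁'⟩ := happ ξ₁ hξ₁pos c hcpos
  set N' := max N₁ (κ * ξ₁)
  have hN'1 := hN₁' N' (le_max_left _ _)
  have hN'2 : κ * ξ₁ ≤ N' := le_max_right _ _
  -- `δ = 2 c`: `Ψ ξ N' ≥ Ψ ξ₁ N' ≥ V ξ₁ - c ≥ V ξ₀ - 2 c` for `ξ` in `[ξ₀, ξ₁]`.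
  have hg := null_flux_gronwall (C := D) (δ := 2 * c) hξ₀' h1 h3 hN'2 hΨc hqc hΨξ hΨη hqη hp hq
    ?_ ?_
  · have h4 : Ψ ξ₀ N' ≤ V ξ₀ := hle ξ₀ N' hξ₀' (by linarith)
    have h5 := hN₀' (κ * ξ₁) h2
    have h6 : D ^ 2 / (κ * ξ₁) * (ξ₁ - ξ₀) ≤ D ^ 2 := by
      rw [div_mul_eq_mul_div, div_le_iff₀ (by linarith)]
      exact mul_le_mul_of_nonneg_left (by linarith) (sq_nonneg _)
    have h7 : (2 * (Ψ ξ₀ N' - Ψ ξ₀ (κ * ξ₁)) + 2 * c) * Real.exp (D ^ 2 / (κ * ξ₁) * (ξ₁ - ξ₀))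
        ≤ 4 * c * Real.exp (D ^ 2) := by
      refine mul_le_mul (by linarith) (Real.exp_le_exp.2 h6) (Real.exp_pos _).le (by linarith)
    have h8 : Ψ A η ≤ V ξ₀ :=
      (hle A η (hξ₀'.trans_le hA) hη).trans (hVanti ξ₀ A hξ₀' hA)
    have h9 := htail ξ₁ hξ₁pos
    have h10 : c * (2 + 4 * Real.exp (D ^ 2)) = ε := div_mul_cancel₀ _ (by positivity)
    linarith
  · intro ξ η h4 h5 h6
    have hξpos := hξ₀'.trans_le h4
    have hηpos : 0 < η := by linarith
    refine (hl ξ η hξpos (by linarith)).trans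
      (mul_le_mul_of_nonneg_right ?_ (Real.sqrt_nonneg _))
    rw [hD, div_div]
    refine div_le_div_of_nonneg_left hC (by positivity) ?_
    have : ξ ≤ κ⁻¹ * η := by
      rw [le_inv_mul_iff₀ (by linarith)]
      exact (mul_le_mul_of_nonneg_left h5 (by linarith)).trans h6
    linarith
  · intro ξ h4 h5
    have e1 : Ψ ξ₀ N' ≤ V ξ₀ := hle ξ₀ N' hξ₀' (by linarith)
    have e2 := hanti ξ ξ₁ N' (hξ₀'.trans_le h4) h5 (by linarith)
    have e3 := htail ξ₁ hξ₁pos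
    linarith

/-! ### Radial conservation laws on the half-plane of times and radii -/

/-- The energy in a disc of a radial energy density. -/
noncomputable def radialEnergy (e : ℝ × ℝ → ℝ) (t r : ℝ) : ℝ :=
  ∫ s in (0 : ℝ)..r, s * e (max t 0, s)

variable {e m : ℝ × ℝ → ℝ}

/-- Freezing the density at its initial value for negative times extends it continuously to the
plane, so the disc energy needs no special treatment at `t = 0`. -/
theorem continuous_max_time (he0 : ContinuousOn e {z | 0 ≤ z.1}) :
    Continuous fun z : ℝ × ℝ => e (max z.1 0, z.2) :=
  he0.comp_continuous (by fun_prop) fun z => le_max_right z.1 0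

theorem continuous_radialEnergy (he0 : ContinuousOn e {z | 0 ≤ z.1}) :
    Continuous fun z : ℝ × ℝ => radialEnergy e z.1 z.2 := by
  refine intervalIntegral.continuous_parametric_intervalIntegral_of_continuous
    (f := fun (z : ℝ × ℝ) s => s * e (max z.1 0, s)) (s := fun z => z.2) ?_ continuous_snd
  exact continuous_snd.mul ((continuous_max_time he0).comp
    (f := fun z : (ℝ × ℝ) × ℝ => (z.1.1, z.2)) (by fun_prop))

theorem hasDerivAt_radialEnergy_right (he0 : ContinuousOn e {z | 0 ≤ z.1}) {t : ℝ} (ht : 0 < t)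
    (r : ℝ) : HasDerivAt (fun r => radialEnergy e t r) (r * e (t, r)) r := by
  have hc : Continuous fun s => s * e (max t 0, s) :=
    continuous_id.mul ((continuous_max_time he0).comp (f := fun s => (t, s)) (by fun_prop))
  have := intervalIntegral.integral_hasDerivAt_right (hc.intervalIntegrable 0 r)
    (hc.stronglyMeasurableAtFilter _ _) hc.continuousAt
  simpa [radialEnergy, max_eq_left ht.le] using this

theorem isOpen_posTime : IsOpen {z : ℝ × ℝ | 0 < z.1} := isOpen_lt continuous_const continuous_fst

theorem hasFDerivAt_of_posTime (he : ContDiffOn ℝ 1 e {z | 0 < z.1}) {t : ℝ} (ht : 0 < t) (r : ℝ) :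
    HasFDerivAt e (fderiv ℝ e (t, r)) (t, r) :=
  ((he.contDiffAt (isOpen_posTime.mem_nhds ht)).differentiableAt one_ne_zero).hasFDerivAt

theorem continuousOn_fderiv_posTime (he : ContDiffOn ℝ 1 e {z | 0 < z.1}) (v : ℝ × ℝ) :
    ContinuousOn (fun z => fderiv ℝ e z v) {z | 0 < z.1} :=
  (he.continuousOn_fderiv_of_isOpen isOpen_posTime le_rfl).clm_apply continuousOn_const

/-- By the conservation law the differentiated integrand is `∂_s (s m)`, so only the flux through
the circle of radius `r` remains; the boundary term at the origin carries the factor `s = 0`. -/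
theorem hasDerivAt_radialEnergy_left (he : ContDiffOn ℝ 1 e {z | 0 < z.1})
    (hm : ContDiffOn ℝ 1 m {z | 0 < z.1}) (he0 : ContinuousOn e {z | 0 ≤ z.1})
    (hcons : ∀ t r, 0 < t → 0 < r →
      r * fderiv ℝ e (t, r) (1, 0) = m (t, r) + r * fderiv ℝ m (t, r) (0, 1))
    {t r : ℝ} (ht : 0 < t) (hr : 0 ≤ r) :
    HasDerivAt (fun t => radialEnergy e t r) (r * m (t, r)) t := by
  have hpos : ∀ x ∈ Metric.closedBall t (t / 2), 0 < x := by
    intro x hx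
    rw [Metric.mem_closedBall, Real.dist_eq, abs_le] at hx
    linarith [hx.1]
  have h1 : HasDerivAt (fun t => radialEnergy e t r)
      (∫ s in (0 : ℝ)..r, s * fderiv ℝ e (t, s) (1, 0)) t := by
    refine hasDerivAt_intervalIntegral_param
      (F' := fun t s => s * fderiv ℝ e (t, s) (1, 0)) (half_pos ht) ?_ ?_ ?_
    · intro x _
      exact (continuous_id.mul ((continuous_max_time he0).comp
        (f := fun s => (x, s)) (by fun_prop))).continuousOn
    · intro x hx s _
      refine HasDerivAt.const_mul s ?_
      have h2 : HasDerivAt (fun y => e (y, s)) (fderiv ℝ e (x, s) (1, 0)) x :=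
        (hasFDerivAt_of_posTime he (hpos x hx) s).comp_hasDerivAt x
          ((hasDerivAt_id x).prodMk (hasDerivAt_const x s))
      refine h2.congr_of_eventuallyEq ?_
      filter_upwards [lt_mem_nhds (hpos x hx)] with y hy
      rw [max_eq_left hy.le]
    · exact continuousOn_snd.mul ((continuousOn_fderiv_posTime he _).mono
        fun z hz => hpos z.1 hz.1)
  convert! h1 using 1
  have hmc : ContinuousOn m {z | 0 < z.1} := hm.continuousOn
  have hsec : Continuous fun s : ℝ => s * m (t, s) :=
    continuous_id.mul (hmc.comp_continuous (f := fun s => (t, s)) (by fun_prop) fun s => ht)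
  rw [intervalIntegral.integral_eq_sub_of_hasDerivAt_of_le hr (f := fun s => s * m (t, s))
    hsec.continuousOn]
  · simp
  · intro s hs
    rw [hcons t s ht hs.1]
    have h2 : HasDerivAt (fun s => m (t, s)) (fderiv ℝ m (t, s) (0, 1)) s :=
      (hasFDerivAt_of_posTime hm ht s).comp_hasDerivAt s
        ((hasDerivAt_const s t).prodMk (hasDerivAt_id s))
    simpa only [one_mul, id] using! (hasDerivAt_id s).mul h2
  · refine Continuous.intervalIntegrable ?_ _ _
    exact continuous_id.mul ((continuousOn_fderiv_posTime he _).comp_continuous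
      (f := fun s => (t, s)) (by fun_prop) fun s => ht)

/-- Both partial derivatives exist nearby and are continuous at the point. Joint differentiability
is what permits differentiation along null directions. -/
theorem hasFDerivAt_radialEnergy (he : ContDiffOn ℝ 1 e {z | 0 < z.1})
    (hm : ContDiffOn ℝ 1 m {z | 0 < z.1}) (he0 : ContinuousOn e {z | 0 ≤ z.1})
    (hcons : ∀ t r, 0 < t → 0 < r →
      r * fderiv ℝ e (t, r) (1, 0) = m (t, r) + r * fderiv ℝ m (t, r) (0, 1))
    {t r : ℝ} (ht : 0 < t) (hr : 0 < r) :
    HasFDerivAt (fun z : ℝ × ℝ => radialEnergy e z.1 z.2)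
      ((ContinuousLinearMap.toSpanSingleton ℝ (r * m (t, r))).coprod
        (ContinuousLinearMap.toSpanSingleton ℝ (r * e (t, r)))) (t, r) := by
  have hev : ∀ᶠ v : ℝ × ℝ in 𝓝 (t, r), 0 < v.1 ∧ 0 < v.2 :=
    (continuous_fst.continuousAt.eventually (lt_mem_nhds ht)).and
      (continuous_snd.continuousAt.eventually (lt_mem_nhds hr))
  have hcont : ∀ f : ℝ × ℝ → ℝ, ContDiffOn ℝ 1 f {z | 0 < z.1} →
      ContinuousAt (fun z : ℝ × ℝ => ContinuousLinearMap.toSpanSingleton ℝ (z.2 * f z)) (t, r) := by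
    intro f hf
    have h1 : ContinuousAt f (t, r) := hf.continuousOn.continuousAt (isOpen_posTime.mem_nhds ht)
    exact (ContinuousLinearMap.toSpanSingletonCLE (𝕜 := ℝ) (E := ℝ)).continuous.continuousAt.comp
      (continuous_snd.continuousAt.mul h1)
  refine (hasStrictFDerivAt_uncurry_coprod (f := fun t r => radialEnergy e t r)
    (f₁ := fun t r => ContinuousLinearMap.toSpanSingleton ℝ (r * m (t, r)))
    (f₂ := fun t r => ContinuousLinearMap.toSpanSingleton ℝ (r * e (t, r)))
    ?_ ?_ (hcont m hm) (hcont e he)).hasFDerivAt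
  · filter_upwards [hev] with v hv
    exact (hasDerivAt_radialEnergy_left he hm he0 hcons hv.1 hv.2.le).hasFDerivAt
  · filter_upwards [hev] with v hv
    exact (hasDerivAt_radialEnergy_right he0 hv.1 v.2).hasFDerivAt

/-- A radial energy density `e` with momentum density `m` on `(1+2)`-dimensional Minkowski space,
subject to the conservation law `∂_t (r e) = ∂_r (r m)` and the bound
`|∂_t (r m) - ∂_r (r e)| ≤ C √(e² - m²)`, has vanishing energy in the region
`lam T < r < T - A` as `T, A → ∞`. -/
theorem radial_energy_vanishing {C E lam : ℝ} (hC : 0 ≤ C) (hlam₀ : 0 < lam) (hlam₁ : lam < 1)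
    (he : ContDiffOn ℝ 1 e {z | 0 < z.1})
    (hm : ContDiffOn ℝ 1 m {z | 0 < z.1}) (he0 : ContinuousOn e {z | 0 ≤ z.1})
    (hme : ∀ z : ℝ × ℝ, 0 < z.1 → |m z| ≤ e z)
    (hcons : ∀ t r, 0 < t → 0 < r →
      r * fderiv ℝ e (t, r) (1, 0) = m (t, r) + r * fderiv ℝ m (t, r) (0, 1))
    (hL : ∀ t r, 0 < t → 0 < r →
      |r * fderiv ℝ m (t, r) (1, 0) - (e (t, r) + r * fderiv ℝ e (t, r) (0, 1))|
        ≤ C * √((e (t, r) + m (t, r)) * (e (t, r) - m (t, r))))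
    (hE : ∀ R, 0 ≤ R → ∫ s in (0 : ℝ)..R, s * e (0, s) ≤ E) {ε : ℝ} (hε : 0 < ε) :
    ∃ T₀ > 0, ∃ A₀ > 0, ∀ T ≥ T₀, ∀ A ≥ A₀, A ≤ (1 - lam) * T →
      ∫ s in (lam * T)..(T - A), s * e (T, s) ≤ ε := by
  have hnull : ∀ (f : ℝ × ℝ → ℝ) (f' : ℝ × ℝ →L[ℝ] ℝ) (ξ η : ℝ),
      HasFDerivAt f f' ((ξ + η) / 2, (η - ξ) / 2) →
      HasDerivAt (fun x => f ((x + η) / 2, (η - x) / 2)) (f' (1 / 2, -1 / 2)) ξ ∧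
      HasDerivAt (fun y => f ((ξ + y) / 2, (y - ξ) / 2)) (f' (1 / 2, 1 / 2)) η := by
    intro f f' ξ η h
    exact ⟨h.comp_hasDerivAt ξ ((((hasDerivAt_id ξ).add_const η).div_const 2).prodMk
        (((hasDerivAt_id ξ).const_sub η).div_const 2)),
      h.comp_hasDerivAt η ((((hasDerivAt_id η).const_add ξ).div_const 2).prodMk
        (((hasDerivAt_id η).sub_const ξ).div_const 2))⟩
  have hsplit : ∀ (f' : ℝ × ℝ →L[ℝ] ℝ) (a b : ℝ), f' (a, b) = a * f' (1, 0) + b * f' (0, 1) := by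
    intro f' a b
    have : ((a, b) : ℝ × ℝ) = a • (1, 0) + b • (0, 1) := by simp
    rw [this, map_add, map_smul, map_smul, smul_eq_mul, smul_eq_mul]
  have hΨd : ∀ ξ η, 0 < ξ + η → ξ < η →
      HasDerivAt (fun x => radialEnergy e ((x + η) / 2) ((η - x) / 2))
        (-((η - ξ) / 4 * (e ((ξ + η) / 2, (η - ξ) / 2) - m ((ξ + η) / 2, (η - ξ) / 2)))) ξ ∧
      HasDerivAt (fun y => radialEnergy e ((ξ + y) / 2) ((y - ξ) / 2))
        ((η - ξ) / 4 * (e ((ξ + η) / 2, (η - ξ) / 2) + m ((ξ + η) / 2, (η - ξ) / 2))) η := by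
    intro ξ η h1 h2
    have h := hnull _ _ ξ η (hasFDerivAt_radialEnergy he hm he0 hcons (t := (ξ + η) / 2)
      (r := (η - ξ) / 2) (by linarith) (by linarith))
    refine ⟨?_, ?_⟩
    · convert! h.1 using 1
      simp
      ring
    · convert! h.2 using 1
      simp
      ring
  have hΨc := continuous_radialEnergy he0
  have he_nonneg : ∀ z : ℝ × ℝ, 0 < z.1 → 0 ≤ e z := fun z hz => (abs_nonneg _).trans (hme z hz)
  have hkap : (1 + lam) / (1 - lam) * (1 - lam) = 1 + lam := div_mul_cancel₀ _ (by linarith)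
  -- In null coordinates `r = (η - ξ) / 2`, so `p` and `q` are `r (e ± m) / 2`, and `l` is a quarter
  -- of the defect `∂_t (r m) - ∂_r (r e)`. With this `κ` the ray `η = κ ξ` is `r = lam * t`.
  have hvan := null_potential_vanishing
    (Ψ := fun ξ η => radialEnergy e ((ξ + η) / 2) ((η - ξ) / 2))
    (p := fun ξ η => (η - ξ) / 4 * (e ((ξ + η) / 2, (η - ξ) / 2) + m ((ξ + η) / 2, (η - ξ) / 2)))
    (q := fun ξ η => (η - ξ) / 4 * (e ((ξ + η) / 2, (η - ξ) / 2) - m ((ξ + η) / 2, (η - ξ) / 2)))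
    (l := fun ξ η => ((η - ξ) / 2 * fderiv ℝ m ((ξ + η) / 2, (η - ξ) / 2) (1, 0) -
      (e ((ξ + η) / 2, (η - ξ) / 2) +
        (η - ξ) / 2 * fderiv ℝ e ((ξ + η) / 2, (η - ξ) / 2) (0, 1))) / 4)
    (C := C) (E := E) (κ := (1 + lam) / (1 - lam)) hC
    (by rw [lt_div_iff₀ (by linarith)]; linarith) ?_ ?_ ?_ ?_ ?_ ?_ ?_ ?_ ?_ ?_ hε
  · obtain ⟨A₀, hA₀, X, hX, hmain⟩ := hvan
    refine ⟨X / (1 - lam), div_pos hX (by linarith), A₀, hA₀, ?_⟩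
    intro T hT A hA hAT
    have hXT : X ≤ (1 - lam) * T := by
      rw [ge_iff_le, div_le_iff₀ (by linarith)] at hT
      linarith
    have hTpos : 0 < T := by nlinarith
    -- Both points lie on the slice `t = T`: `(A, 2T - A)` has radius `T - A`, and `((1 - lam) T, (1
    -- + lam) T)` has radius `lam * T`.
    have h := hmain ((1 - lam) * T) hXT A hA (2 * T - A) (by nlinarith)
    have e1 : (A + (2 * T - A)) / 2 = T := by ring
    have e2 : (2 * T - A - A) / 2 = T - A := by ring
    have e3 : (1 + lam) / (1 - lam) * ((1 - lam) * T) = (1 + lam) * T := by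
      rw [← mul_assoc, hkap]
    have e4 : ((1 - lam) * T + (1 + lam) * T) / 2 = T := by ring
    have e5 : ((1 + lam) * T - (1 - lam) * T) / 2 = lam * T := by ring
    simp only [e3, e1, e2, e4, e5] at h
    have hc : Continuous fun s => s * e (max T 0, s) :=
      continuous_id.mul ((continuous_max_time he0).comp (f := fun s => (T, s)) (by fun_prop))
    rw [radialEnergy, radialEnergy, intervalIntegral.integral_interval_sub_left
      (hc.intervalIntegrable _ _) (hc.intervalIntegrable _ _), max_eq_left hTpos.le] at h
    exact h
  · exact (hΨc.comp (f := fun z : ℝ × ℝ => ((z.1 + z.2) / 2, (z.2 - z.1) / 2))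
      (by fun_prop)).continuousOn
  · have hmaps : MapsTo (fun z : ℝ × ℝ => ((z.1 + z.2) / 2, (z.2 - z.1) / 2)) nullDomain
        {z | 0 < z.1} := fun z hz => by
      have h1 := hz.1
      have h2 := hz.2
      show 0 < (z.1 + z.2) / 2
      linarith
    exact ContinuousOn.mul (by fun_prop) ((he.continuousOn.comp (by fun_prop) hmaps).sub
      (hm.continuousOn.comp (by fun_prop) hmaps))
  · exact fun ξ η h1 h2 => (hΨd ξ η (by linarith) h2).1
  · exact fun ξ η h1 h2 => (hΨd ξ η (by linarith) h2).2
  · intro ξ η h1 h2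
    have ht : 0 < (ξ + η) / 2 := by linarith
    have hr : 0 < (η - ξ) / 2 := by linarith
    have hed := (hnull e _ ξ η (hasFDerivAt_of_posTime he ht _)).2
    have hmd := (hnull m _ ξ η (hasFDerivAt_of_posTime hm ht _)).2
    have h := (((hasDerivAt_id η).sub_const ξ).div_const 4).mul (hed.sub hmd)
    convert! h using 1
    rw [hsplit _ (1 / 2) (1 / 2), hsplit _ (1 / 2) (1 / 2)]
    have hc := hcons _ _ ht hr
    simp only [id, Pi.sub_apply]
    linear_combination (-1 / 4) * hc
  · intro ξ η h1 h2
    have := abs_le.1 (hme ((ξ + η) / 2, (η - ξ) / 2) (by simp only; linarith))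
    exact mul_nonneg (by linarith) (by linarith [this.1])
  · intro ξ η h1 h2
    have := abs_le.1 (hme ((ξ + η) / 2, (η - ξ) / 2) (by simp only; linarith))
    exact mul_nonneg (by linarith) (by linarith [this.2])
  · intro ξ η h1 h2
    have ht : 0 < (ξ + η) / 2 := by linarith
    have hr : 0 < (η - ξ) / 2 := by linarith
    have h := hL _ _ ht hr
    rw [abs_div, abs_of_pos (by norm_num : (0 : ℝ) < 4), div_le_iff₀ (by norm_num)]
    refine h.trans (le_of_eq ?_)
    -- Here `√(p q) = (η - ξ) / 4 * √(e² - m²)`, so the factor `1 / 4` in `l` leaves exactly `C / (η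
    -- - ξ)`.
    set a := e ((ξ + η) / 2, (η - ξ) / 2) with ha
    set b := m ((ξ + η) / 2, (η - ξ) / 2) with hb
    have e1 : (η - ξ) / 4 * (a + b) * ((η - ξ) / 4 * (a - b)) =
        ((η - ξ) / 4) ^ 2 * ((a + b) * (a - b)) := by ring
    rw [e1, Real.sqrt_mul (sq_nonneg _), Real.sqrt_sq (by linarith)]
    have : η - ξ ≠ 0 := by linarith
    field_simp
  · intro ξ η h1 h2
    refine intervalIntegral.integral_nonneg (by linarith) fun s hs => mul_nonneg hs.1 ?_
    exact he_nonneg _ (lt_max_of_lt_left (by linarith))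
  · intro ξ η h1 h2
    -- Finite speed of propagation: following the backward light cone `t + r = η` from `ξ` down to
    -- `-η`, that is to `t = 0` and `r = η`, the disc energy does not decrease.
    have hanti := antitoneOn_Icc_of_hasDerivAt (a := -η) (b := ξ)
      (f := fun x => radialEnergy e ((x + η) / 2) ((η - x) / 2))
      (f' := fun ξ => -((η - ξ) / 4 *
        (e ((ξ + η) / 2, (η - ξ) / 2) - m ((ξ + η) / 2, (η - ξ) / 2))))
      (hΨc.comp (f := fun x : ℝ => ((x + η) / 2, (η - x) / 2)) (by fun_prop)).continuousOn
      (fun x hx => (hΨd x η (by linarith [hx.1]) (by linarith [hx.2])).1) ?_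
    · have h := hanti ⟨le_rfl, by linarith⟩ ⟨by linarith, le_rfl⟩ (by linarith : -η ≤ ξ)
      refine h.trans ?_
      simp only [neg_add_cancel, zero_div, sub_neg_eq_add, add_self_div_two]
      have := hE η (by linarith)
      simpa [radialEnergy] using this
    · intro x hx
      have hx1 := hx.1
      have hx2 := hx.2
      have := abs_le.1 (hme ((x + η) / 2, (η - x) / 2) (by simp only; linarith))
      exact neg_nonpos.2 (mul_nonneg (by linarith) (by linarith [this.2]))

end RealAnalysis

/-! ### The pullback metric and the metric in a chart -/

section Geometry

open Set Filter Topology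

variable {n : ℕ} {M : Type*} [TopologicalSpace M] [ChartedSpace (Euc n) M]
  [IsManifold (𝓡 n) ∞ M]

section Pullback

variable {E : Type*} [NormedAddCommGroup E] [NormedSpace ℝ E]

/-- The pullback of the metric `g` under `f`, with derivatives taken within `s`. -/
noncomputable def pullbackMetric (g : SmoothMetric n M) (f : E → M) (s : Set E) (z v w : E) : ℝ :=
  g.inner (f z) (mfderivWithin 𝓘(ℝ, E) (𝓡 n) f s z v) (mfderivWithin 𝓘(ℝ, E) (𝓡 n) f s z w)

theorem contMDiffOn_mfderivWithin_const_apply {f : E → M} {s : Set E} (hs : UniqueDiffOn ℝ s)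
    (hf : ContMDiffOn 𝓘(ℝ, E) (𝓡 n) ∞ f s) (v : E) :
    ContMDiffOn 𝓘(ℝ, E) ((𝓡 n).prod 𝓘(ℝ, Euc n)) ∞
      (fun z => (Bundle.TotalSpace.mk' (Euc n) (f z) (mfderivWithin 𝓘(ℝ, E) (𝓡 n) f s z v) :
        TangentBundle (𝓡 n) M)) s := by
  have : IsManifold (𝓡 n) 1 M := IsManifold.of_le (n := ∞) (by norm_cast)
  have h1 := hf.contMDiffOn_tangentMapWithin (m := ∞) (by simp) hs.uniqueMDiffOn
  have h2 : ContMDiffOn 𝓘(ℝ, E) 𝓘(ℝ, E).tangent ∞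
      (fun z => (⟨z, v⟩ : TangentBundle 𝓘(ℝ, E) E)) s :=
    contMDiffOn_vectorSpace_iff_contDiffOn.2 contDiffOn_const
  exact h1.comp h2 fun z hz => hz

theorem contDiffOn_pullbackMetric (g : SmoothMetric n M) {f : E → M} {s : Set E}
    (hs : UniqueDiffOn ℝ s) (hf : ContMDiffOn 𝓘(ℝ, E) (𝓡 n) ∞ f s) (v w : E) :
    ContDiffOn ℝ ∞ (fun z => pullbackMetric g f s z v w) s := by
  intro z hz
  have h := ContMDiffWithinAt.clm_bundle_apply₂ (F₁ := Euc n) (F₂ := Euc n) (F₃ := ℝ)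
    (E₃ := Bundle.Trivial M ℝ) (b := f) (ψ := fun z => g.inner (f z)) (s := s) (x := z)
    (g.contMDiff.contMDiffAt.comp_contMDiffWithinAt z (hf z hz))
    (contMDiffOn_mfderivWithin_const_apply hs hf v z hz)
    (contMDiffOn_mfderivWithin_const_apply hs hf w z hz)
  rw [Bundle.contMDiffWithinAt_totalSpace] at h
  exact h.2.contDiffWithinAt

variable (g : SmoothMetric n M) (f : E → M) (s : Set E) (z : E)

theorem pullbackMetric_symm (v w : E) : pullbackMetric g f s z v w = pullbackMetric g f s z w v :=
  g.symm _ _ _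

theorem pullbackMetric_add_left (v v' w : E) :
    pullbackMetric g f s z (v + v') w = pullbackMetric g f s z v w + pullbackMetric g f s z v' w := by
  let L : E →L[ℝ] TangentSpace (𝓡 n) (f z) := mfderivWithin 𝓘(ℝ, E) (𝓡 n) f s z
  change g.inner (f z) (L (v + v')) (L w) = _
  rw [map_add, map_add]
  rfl

theorem pullbackMetric_smul_left (c : ℝ) (v w : E) :
    pullbackMetric g f s z (c • v) w = c * pullbackMetric g f s z v w := by
  let L : E →L[ℝ] TangentSpace (𝓡 n) (f z) := mfderivWithin 𝓘(ℝ, E) (𝓡 n) f s z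
  change g.inner (f z) (L (c • v)) (L w) = _
  rw [map_smul, map_smul]
  rfl

theorem pullbackMetric_add_right (v w w' : E) :
    pullbackMetric g f s z v (w + w') = pullbackMetric g f s z v w + pullbackMetric g f s z v w' := by
  rw [pullbackMetric_symm, pullbackMetric_add_left, pullbackMetric_symm _ _ _ _ w,
    pullbackMetric_symm _ _ _ _ w']

theorem pullbackMetric_smul_right (c : ℝ) (v w : E) :
    pullbackMetric g f s z v (c • w) = c * pullbackMetric g f s z v w := by
  rw [pullbackMetric_symm, pullbackMetric_smul_left, pullbackMetric_symm]

theorem metric_self_nonneg (p : M) (v : TangentSpace (𝓡 n) p) : 0 ≤ g.inner p v v := by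
  by_cases hv : v = 0
  · rw [hv, map_zero]
  · exact (g.pos p v hv).le

theorem pullbackMetric_self_nonneg (v : E) : 0 ≤ pullbackMetric g f s z v v :=
  metric_self_nonneg g _ _

/-- Cauchy–Schwarz for a form that is only semidefinite, since the derivative of `f` may have a
kernel; hence the discriminant argument. -/
theorem pullbackMetric_sq_le (v w : E) :
    pullbackMetric g f s z v w ^ 2 ≤ pullbackMetric g f s z v v * pullbackMetric g f s z w w := by
  have h : ∀ x : ℝ, 0 ≤ pullbackMetric g f s z w w * (x * x) +
      (2 * pullbackMetric g f s z v w) * x + pullbackMetric g f s z v v := by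
    intro x
    have := pullbackMetric_self_nonneg g f s z (v + x • w)
    simp only [pullbackMetric_add_left, pullbackMetric_add_right, pullbackMetric_smul_left,
      pullbackMetric_smul_right, pullbackMetric_symm g f s z w v] at this
    linarith
  have := discrim_le_zero h
  rw [discrim] at this
  linarith

end Pullback

section Chart

variable (g : SmoothMetric n M) (p₀ : M)

local notation "φ" => chartAt (Euc n) p₀

theorem contMDiffOn_chartAt_symm : ContMDiffOn (𝓡 n) (𝓡 n) ∞ (φ).symm (φ).target :=
  contMDiffOn_chart_symm

theorem metricMatrix_eq_pullbackMetric {y : Euc n} (hy : y ∈ (φ).target) (k l : Fin n) :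
    metricMatrix g φ y k l = pullbackMetric g (φ).symm (φ).target y
      (EuclideanSpace.single k 1) (EuclideanSpace.single l 1) := by
  unfold pullbackMetric metricMatrix coordVec
  rw [mfderivWithin_of_isOpen (φ).open_target hy]
  rfl

theorem contDiffAt_metricMatrix {y : Euc n} (hy : y ∈ (φ).target) (k l : Fin n) :
    ContDiffAt ℝ ∞ (fun y => metricMatrix g φ y k l) y := by
  have h := contDiffOn_pullbackMetric g (φ).open_target.uniqueDiffOn
    (contMDiffOn_chartAt_symm (n := n) p₀) (EuclideanSpace.single k 1) (EuclideanSpace.single l 1)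
  refine (h.congr fun y hy => metricMatrix_eq_pullbackMetric g p₀ hy k l).contDiffAt ?_
  exact (φ).open_target.mem_nhds hy

theorem euclideanSpace_eq_sum_single (a : Euc n) :
    a = ∑ k, a k • (EuclideanSpace.single k 1 : Euc n) := by
  ext i
  simp [Finset.sum_apply, Pi.single_apply]

theorem metric_sum_eq (p : M) (e : Fin n → TangentSpace (𝓡 n) p) (a b : Fin n → ℝ) :
    g.inner p (∑ k, a k • e k) (∑ l, b l • e l) =
      ∑ k, ∑ l, g.inner p (e k) (e l) * a k * b l := by
  simp only [map_sum, sum_apply]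
  rw [Finset.sum_comm]
  refine Finset.sum_congr rfl fun k _ => ?_
  refine Finset.sum_congr rfl fun l _ => ?_
  rw [map_smul, map_smul, smul_apply, smul_eq_mul, smul_eq_mul]
  ring

/-- The metric in terms of the coordinates of tangent vectors. -/
theorem metric_mfderiv_chart_symm (y a b : Euc n) :
    g.inner ((φ).symm y) (mfderiv (𝓡 n) (𝓡 n) (φ).symm y a) (mfderiv (𝓡 n) (𝓡 n) (φ).symm y b) =
      ∑ k, ∑ l, metricMatrix g φ y k l * a k * b l := by
  have h : ∀ a : Euc n, mfderiv (𝓡 n) (𝓡 n) (φ).symm y a = ∑ k, a k • coordVec φ y k := by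
    intro a
    conv_lhs => rw [euclideanSpace_eq_sum_single a]
    erw [map_sum]
    refine Finset.sum_congr rfl fun k _ => ?_
    erw [map_smul]
    rfl
  rw [h a, h b, metric_sum_eq]
  rfl

theorem metricMatrix_symm (y : Euc n) (k l : Fin n) :
    metricMatrix g φ y k l = metricMatrix g φ y l k := g.symm _ _ _

theorem metricMatrix_pos {y : Euc n} (hy : y ∈ (φ).target) {a : Euc n} (ha : a ≠ 0) :
    0 < ∑ k, ∑ l, metricMatrix g φ y k l * a k * a l := by
  have : IsManifold (𝓡 n) 1 M := IsManifold.of_le (n := ∞) (by norm_cast)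
  rw [← metric_mfderiv_chart_symm]
  refine g.pos _ _ fun h => ha ?_
  have h1 := (mdifferentiable_chart (I := 𝓡 n) p₀).symm.mfderiv_injective (x := y) hy
  exact h1 (h.trans (map_zero _).symm)

/-- A kernel vector would have length zero. Invertibility gives the matrix inverse in `christoffel`
its intended meaning. -/
theorem isUnit_metricMatrix {y : Euc n} (hy : y ∈ (φ).target) : IsUnit (metricMatrix g φ y) := by
  rw [← Matrix.mulVec_injective_iff_isUnit]
  refine (injective_iff_map_eq_zero (metricMatrix g φ y).mulVecLin).2 fun a ha => ?_
  by_contra hne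
  have h := metricMatrix_pos g p₀ hy (a := WithLp.toLp 2 a) (by simpa using hne)
  refine h.ne' ?_
  refine Finset.sum_eq_zero fun k _ => ?_
  have := congrFun ha k
  simp only [Matrix.mulVecLin_apply, Matrix.mulVec, dotProduct, Pi.zero_apply] at this
  calc _ = a k * ∑ l, metricMatrix g φ y k l * a l := by
        rw [Finset.mul_sum]
        exact Finset.sum_congr rfl fun l _ => by simp only; ring
    _ = 0 := by rw [this, mul_zero]

end Chart

end Geometry

/-! ### The stress-energy tensor of a wave map -/

section StressEnergy

open Set Filter Topology

/-- The coordinate directions `∂_t, ∂_1, ∂_2`. -/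
noncomputable def coordDir : Fin 3 → SpaceTime := ![timeDir, spaceDir 0, spaceDir 1]

/-- The diagonal entries of the Minkowski metric. -/
noncomputable def minkowskiSign : Fin 3 → ℝ := ![-1, 1, 1]

/-- The algebraic identity behind the conservation of the stress-energy tensor: `D c a b` is the
expansion of `∂_c (G_{kl} v1^k_a v1^l_b)`, and `hwave` is the wave map equation. -/
theorem stress_energy_algebra {n : ℕ} {ι : Type*} [Fintype ι] (η : ι → ℝ)
    (G : Matrix (Fin n) (Fin n) ℝ) (dG : Fin n → Fin n → Fin n → ℝ)
    (v1 : ι → Fin n → ℝ) (v2 : ι → ι → Fin n → ℝ) (hG : IsUnit G)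
    (hGs : ∀ k l, G k l = G l k) (hdG : ∀ m k l, dG m k l = dG m l k)
    (hv2 : ∀ a b k, v2 a b k = v2 b a k)
    (hwave : ∀ i, -∑ a, η a * v2 a a i = ∑ k, ∑ l,
      ((1 / 2) * ∑ m, G⁻¹ i m * (dG k m l + dG l m k - dG m k l)) * ∑ a, η a * (v1 a k * v1 a l))
    (D : ι → ι → ι → ℝ)
    (hD : ∀ c a b, D c a b = ∑ k, ∑ l, ((∑ m, dG m k l * v1 c m) * v1 a k * v1 b l +
      G k l * v2 c a k * v1 b l + G k l * v1 a k * v2 c b l)) (b : ι) :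
    ∑ a, η a * (D a a b - 1 / 2 * D b a a) = 0 := by
  set N : Fin n → Fin n → ℝ := fun k l => ∑ a, η a * (v1 a k * v1 a l) with hN
  have hNs : ∀ k l, N k l = N l k := fun k l => Finset.sum_congr rfl fun a _ => by ring
  -- The wave map equation with its index lowered: `G G⁻¹ = 1` removes the inverse metric, and the
  -- first two Christoffel terms coincide because `N` is symmetric.
  have hlow : ∀ j, -∑ i, G j i * ∑ a, η a * v2 a a i =
      ∑ k, ∑ l, (dG k l j - 1 / 2 * dG j k l) * N k l := by
    intro j
    have h1 : -∑ i, G j i * ∑ a, η a * v2 a a i = ∑ i, G j i * ∑ k, ∑ l,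
        ((1 / 2) * ∑ m, G⁻¹ i m * (dG k m l + dG l m k - dG m k l)) * N k l := by
      rw [← Finset.sum_neg_distrib]
      refine Finset.sum_congr rfl fun i _ => ?_
      rw [← hwave i]
      ring
    have h2 : ∀ X : Fin n → ℝ, ∑ i, G j i * ∑ m, G⁻¹ i m * X m = X j := by
      intro X
      have := congrFun (Matrix.mulVec_mulVec X G G⁻¹) j
      rw [Matrix.mul_nonsing_inv _ ((Matrix.isUnit_iff_isUnit_det _).1 hG),
        Matrix.one_mulVec] at this
      simpa only [Matrix.mulVec, dotProduct] using this
    have h3 : ∑ i, G j i * ∑ k, ∑ l,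
        ((1 / 2) * ∑ m, G⁻¹ i m * (dG k m l + dG l m k - dG m k l)) * N k l =
        ∑ k, ∑ l, (1 / 2) * (dG k j l + dG l j k - dG j k l) * N k l := by
      have h4 : ∀ T : Fin n → Fin n → Fin n → ℝ, ∑ i, G j i * ∑ k, ∑ l, T i k l =
          ∑ k, ∑ l, ∑ i, G j i * T i k l := by
        intro T
        simp only [Finset.mul_sum]
        rw [Finset.sum_comm]
        exact Finset.sum_congr rfl fun k _ => Finset.sum_comm
      have h5 : ∀ (Y : Fin n → ℝ) (c : ℝ), ∑ i, G j i * ((1 / 2) * Y i * c) =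
          (1 / 2) * (∑ i, G j i * Y i) * c := by
        intro Y c
        rw [Finset.mul_sum, Finset.sum_mul]
        exact Finset.sum_congr rfl fun i _ => by ring
      rw [h4]
      refine Finset.sum_congr rfl fun k _ => Finset.sum_congr rfl fun l _ => ?_
      rw [h5, h2 fun m => dG k m l + dG l m k - dG m k l]
    rw [h1, h3]
    have h4 : ∑ k, ∑ l, 1 / 2 * dG k j l * N k l = ∑ k, ∑ l, 1 / 2 * dG l j k * N k l := by
      rw [Finset.sum_comm]
      refine Finset.sum_congr rfl fun k _ => Finset.sum_congr rfl fun l _ => ?_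
      rw [hNs]
    have h5 : ∑ k, ∑ l, (1 / 2) * (dG k j l + dG l j k - dG j k l) * N k l =
        ∑ k, ∑ l, 1 / 2 * dG k j l * N k l + ∑ k, ∑ l, 1 / 2 * dG l j k * N k l -
          ∑ k, ∑ l, 1 / 2 * dG j k l * N k l := by
      rw [← Finset.sum_add_distrib, ← Finset.sum_sub_distrib]
      refine Finset.sum_congr rfl fun k _ => ?_
      rw [← Finset.sum_add_distrib, ← Finset.sum_sub_distrib]
      exact Finset.sum_congr rfl fun l _ => by ring
    rw [h5, ← h4, ← Finset.sum_add_distrib, ← Finset.sum_sub_distrib]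
    refine Finset.sum_congr rfl fun k _ => ?_
    rw [← Finset.sum_add_distrib, ← Finset.sum_sub_distrib]
    refine Finset.sum_congr rfl fun l _ => ?_
    rw [hdG k j l]
    ring
  -- The mixed second derivatives cancel: symmetry of `G` and `v2` makes the two such terms of `D b
  -- a a` equal, and their half-sum is the mixed term of `D a a b`. Only the unmixed `v2 a a`
  -- survive.
  have hT : ∀ a, D a a b - 1 / 2 * D b a a =
      ∑ k, ∑ l, ((∑ m, dG m k l * v1 a m) * v1 a k * v1 b l + G k l * v2 a a k * v1 b l -
        1 / 2 * (∑ m, dG m k l * v1 b m) * v1 a k * v1 a l) := by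
    intro a
    have h1 : ∑ k, ∑ l, G k l * v2 b a k * v1 a l = ∑ k, ∑ l, G k l * v1 a k * v2 a b l := by
      rw [Finset.sum_comm]
      refine Finset.sum_congr rfl fun k _ => Finset.sum_congr rfl fun l _ => ?_
      rw [hGs, hv2]
      ring
    have h2 : ∑ k, ∑ l, G k l * v1 a k * v2 b a l = ∑ k, ∑ l, G k l * v1 a k * v2 a b l :=
      Finset.sum_congr rfl fun k _ => Finset.sum_congr rfl fun l _ => by rw [hv2]
    have h3 : ∀ S : Fin n → Fin n → ℝ, ∑ k, ∑ l, 1 / 2 * S k l * v1 a k * v1 a l =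
        1 / 2 * ∑ k, ∑ l, S k l * v1 a k * v1 a l := by
      intro S
      simp only [Finset.mul_sum, mul_assoc]
    simp only [hD, Finset.sum_add_distrib, Finset.sum_sub_distrib]
    rw [h1, h2, h3 fun k l => ∑ m, dG m k l * v1 b m]
    ring
  -- The divergence is the lowered wave equation `hlow` contracted with `v1 b`.
  have hsum : ∑ a, η a * (D a a b - 1 / 2 * D b a a) =
      (∑ j, v1 b j * ∑ k, ∑ l, (dG k l j - 1 / 2 * dG j k l) * N k l) +
        ∑ j, v1 b j * ∑ i, G j i * ∑ a, η a * v2 a a i := by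
    have e1 : ∀ a, η a * (D a a b - 1 / 2 * D b a a) =
        (∑ j, ∑ k, ∑ l, v1 b j * ((dG k l j - 1 / 2 * dG j k l) * (η a * (v1 a k * v1 a l)))) +
          ∑ j, ∑ i, v1 b j * (G j i * (η a * v2 a a i)) := by
      intro a
      rw [hT a]
      simp only [Finset.sum_add_distrib, Finset.sum_sub_distrib, sub_mul, mul_sub, mul_add]
      have f1 : η a * ∑ k, ∑ l, (∑ m, dG m k l * v1 a m) * v1 a k * v1 b l =
          ∑ j, ∑ k, ∑ l, v1 b j * (dG k l j * (η a * (v1 a k * v1 a l))) := by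
        simp only [Finset.mul_sum, Finset.sum_mul]
        rw [Finset.sum_comm]
        refine Finset.sum_congr rfl fun j _ => ?_
        rw [Finset.sum_comm]
        refine Finset.sum_congr rfl fun k _ => Finset.sum_congr rfl fun l _ => ?_
        ring
      have f2 : η a * ∑ k, ∑ l, G k l * v2 a a k * v1 b l =
          ∑ j, ∑ i, v1 b j * (G j i * (η a * v2 a a i)) := by
        simp only [Finset.mul_sum]
        rw [Finset.sum_comm]
        refine Finset.sum_congr rfl fun j _ => Finset.sum_congr rfl fun i _ => ?_
        rw [hGs i j]
        ring
      have f3 : η a * ∑ k, ∑ l, 1 / 2 * (∑ m, dG m k l * v1 b m) * v1 a k * v1 a l =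
          ∑ j, ∑ k, ∑ l, v1 b j * (1 / 2 * dG j k l * (η a * (v1 a k * v1 a l))) := by
        simp only [Finset.mul_sum, Finset.sum_mul]
        rw [Finset.sum_comm]
        conv_lhs =>
          enter [2, l]
          rw [Finset.sum_comm]
        rw [Finset.sum_comm]
        refine Finset.sum_congr rfl fun j _ => ?_
        rw [Finset.sum_comm]
        refine Finset.sum_congr rfl fun k _ => Finset.sum_congr rfl fun l _ => ?_
        ring
      rw [f1, f2, f3]
      ring
    rw [Finset.sum_congr rfl fun a _ => e1 a, Finset.sum_add_distrib]
    congr 1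
    · rw [Finset.sum_comm]
      refine Finset.sum_congr rfl fun j _ => ?_
      rw [Finset.sum_comm, Finset.mul_sum]
      refine Finset.sum_congr rfl fun k _ => ?_
      rw [Finset.sum_comm, Finset.mul_sum]
      refine Finset.sum_congr rfl fun l _ => ?_
      simp only [hN, Finset.mul_sum]
    · rw [Finset.sum_comm]
      refine Finset.sum_congr rfl fun j _ => ?_
      rw [Finset.sum_comm, Finset.mul_sum]
      refine Finset.sum_congr rfl fun k _ => ?_
      simp only [Finset.mul_sum]
  rw [hsum, ← Finset.sum_add_distrib]
  refine Finset.sum_eq_zero fun j _ => ?_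
  rw [← hlow j]
  ring

variable {n : ℕ} {M : Type*} [TopologicalSpace M] [ChartedSpace (Euc n) M]
  [IsManifold (𝓡 n) ∞ M] {u : SpaceTime → M}

theorem futureHalf_mem_nhds {z : SpaceTime} (hz : 0 < z.1) : futureHalf ∈ 𝓝 z :=
  mem_of_superset ((isOpen_lt continuous_const continuous_fst).mem_nhds hz)
    fun w (h : 0 < w.1) => show 0 ≤ w.1 from h.le

theorem uniqueDiffOn_futureHalf : UniqueDiffOn ℝ futureHalf := by
  refine uniqueDiffOn_convex ?_ ⟨timeDir, ?_⟩
  · exact (convex_Ici (0 : ℝ)).linear_preimage (LinearMap.fst ℝ ℝ (Euc 2))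
  · exact mem_interior_iff_mem_nhds.2 (futureHalf_mem_nhds (by simp [timeDir]))

section Chart

variable (g : SmoothMetric n M) (p₀ : M)

local notation "φ" => chartAt (Euc n) p₀

theorem contDiffAt_chart_comp {z : SpaceTime} (hu : ContMDiffAt 𝓘(ℝ, SpaceTime) (𝓡 n) ∞ u z)
    (hz : u z ∈ (φ).source) : ContDiffAt ℝ ∞ (fun w => φ (u w)) z := by
  have h1 : ContMDiffAt (𝓡 n) (𝓡 n) ∞ φ (u z) :=
    (contMDiffOn_chart (I := 𝓡 n) (x := p₀)).contMDiffAt ((φ).open_source.mem_nhds hz)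
  exact (h1.comp z hu).contDiffAt

theorem dirDeriv_coord {z : SpaceTime} {v : SpaceTime → Euc n} (hv : DifferentiableAt ℝ v z)
    (a : SpaceTime) (k : Fin n) : dirDeriv a (fun w => v w k) z = fderiv ℝ v z a k := by
  unfold dirDeriv
  have h := ((EuclideanSpace.proj (𝕜 := ℝ) k).hasFDerivAt (x := v z)).comp z hv.hasFDerivAt
  have h' : HasFDerivAt (fun w => v w k) ((EuclideanSpace.proj (𝕜 := ℝ) k).comp (fderiv ℝ v z)) z := h
  rw [h'.fderiv]
  rfl

theorem mfderiv_eq_chart_symm {z : SpaceTime}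
    (hu : ContMDiffAt 𝓘(ℝ, SpaceTime) (𝓡 n) ∞ u z) (hz : u z ∈ (φ).source) (a : SpaceTime) :
    (mfderiv 𝓘(ℝ, SpaceTime) (𝓡 n) u z a : Euc n) =
      (mfderiv (𝓡 n) (𝓡 n) (φ).symm (φ (u z)) (fderiv ℝ (fun w => φ (u w)) z a) : Euc n) := by
  have : IsManifold (𝓡 n) 1 M := IsManifold.of_le (n := ∞) (by norm_cast)
  have hev : u =ᶠ[𝓝 z] (φ).symm ∘ fun w => φ (u w) := by
    filter_upwards [hu.continuousAt ((φ).open_source.mem_nhds hz)] with w hw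
    exact ((φ).left_inv hw).symm
  have hd : MDifferentiableAt 𝓘(ℝ, SpaceTime) (𝓡 n) (fun w => φ (u w)) z :=
    ((contDiffAt_chart_comp p₀ hu hz).differentiableAt (by simp)).mdifferentiableAt
  have hs : MDifferentiableAt (𝓡 n) (𝓡 n) (φ).symm (φ (u z)) :=
    mdifferentiableAt_atlas_symm (chart_mem_atlas _ _) ((φ).map_source hz)
  have h1 := hev.mfderiv_eq (I := 𝓘(ℝ, SpaceTime)) (I' := 𝓡 n)
  rw [mfderiv_comp z hs hd, mfderiv_eq_fderiv] at h1
  exact congrArg (fun L : SpaceTime →L[ℝ] Euc n => L a) h1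

theorem pullbackMetric_eq_chart {z : SpaceTime} (hu : ContMDiffAt 𝓘(ℝ, SpaceTime) (𝓡 n) ∞ u z)
    (hpos : 0 < z.1) (hz : u z ∈ (φ).source) (a b : SpaceTime) :
    pullbackMetric g u futureHalf z a b = ∑ k, ∑ l, metricMatrix g φ (φ (u z)) k l *
      dirDeriv a (fun w => φ (u w) k) z * dirDeriv b (fun w => φ (u w) l) z := by
  have hv := (contDiffAt_chart_comp p₀ hu hz).differentiableAt (by simp)
  simp only [dirDeriv_coord hv]
  rw [← metric_mfderiv_chart_symm, pullbackMetric,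
    mfderivWithin_of_mem_nhds (futureHalf_mem_nhds hpos)]
  -- All tangent spaces are the model space `Euc n`; regarding the metric as a function of model
  -- vectors allows the base point to be rewritten.
  let F : M → Euc n → Euc n → ℝ := fun p x y =>
    g.inner p (show TangentSpace (𝓡 n) p from x) (show TangentSpace (𝓡 n) p from y)
  change F (u z) (mfderiv 𝓘(ℝ, SpaceTime) (𝓡 n) u z a) (mfderiv 𝓘(ℝ, SpaceTime) (𝓡 n) u z b) =
    F ((φ).symm (φ (u z))) (mfderiv (𝓡 n) (𝓡 n) (φ).symm (φ (u z)) (fderiv ℝ (fun w => φ (u w)) z a))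
      (mfderiv (𝓡 n) (𝓡 n) (φ).symm (φ (u z)) (fderiv ℝ (fun w => φ (u w)) z b))
  rw [(φ).left_inv hz]
  exact congrArg₂ (F (u z)) (mfderiv_eq_chart_symm p₀ hu hz a) (mfderiv_eq_chart_symm p₀ hu hz b)

end Chart

end StressEnergy

section StressEnergy

open Set Filter Topology

theorem hasDerivAt_dirDeriv {f : SpaceTime → ℝ} {z : SpaceTime} (hf : DifferentiableAt ℝ f z)
    (c : SpaceTime) : HasDerivAt (fun s : ℝ => f (z + s • c)) (dirDeriv c f z) 0 := by
  have h1 : HasDerivAt (fun s : ℝ => z + s • c) c 0 := by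
    simpa using ((hasDerivAt_id (0 : ℝ)).smul_const c).const_add z
  have h2 : HasFDerivAt f (fderiv ℝ f z) (z + (0 : ℝ) • c) := by simpa using hf.hasFDerivAt
  exact h2.comp_hasDerivAt 0 h1

theorem contDiffAt_dirDeriv {f : SpaceTime → ℝ} {z : SpaceTime} (hf : ContDiffAt ℝ ∞ f z)
    (c : SpaceTime) : ContDiffAt ℝ ∞ (dirDeriv c f) z :=
  (hf.fderiv_right (m := ∞) (by simp)).clm_apply contDiffAt_const

theorem dirDeriv_comm {f : SpaceTime → ℝ} {z : SpaceTime} (hf : ContDiffAt ℝ ∞ f z)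
    (a b : SpaceTime) : dirDeriv a (dirDeriv b f) z = dirDeriv b (dirDeriv a f) z := by
  have hd : DifferentiableAt ℝ (fderiv ℝ f) z :=
    (hf.fderiv_right (m := ∞) (by simp)).differentiableAt (by simp)
  have h : ∀ a b, dirDeriv a (dirDeriv b f) z = fderiv ℝ (fderiv ℝ f) z a b := by
    intro a b
    have h1 : HasFDerivAt (dirDeriv b f)
        ((ContinuousLinearMap.apply ℝ ℝ b).comp (fderiv ℝ (fderiv ℝ f) z)) z :=
      ((ContinuousLinearMap.apply ℝ ℝ b).hasFDerivAt).comp z hd.hasFDerivAt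
    rw [dirDeriv, h1.fderiv]
    rfl
  rw [h, h]
  have h2 : minSmoothness ℝ 2 ≤ ((⊤ : ℕ∞) : WithTop ℕ∞) := by
    rw [minSmoothness_of_isRCLikeNormedField]
    exact WithTop.coe_le_coe.2 (le_top : (2 : ℕ∞) ≤ ⊤)
  exact (hf.isSymmSndFDerivAt h2) a b

variable {n : ℕ} {M : Type*} [TopologicalSpace M] [ChartedSpace (Euc n) M]
  [IsManifold (𝓡 n) ∞ M] {u : SpaceTime → M}

theorem contDiffAt_pullbackMetric (g : SmoothMetric n M)
    (hu : ContMDiffOn 𝓘(ℝ, SpaceTime) (𝓡 n) ∞ u futureHalf) {z : SpaceTime} (hz : 0 < z.1)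
    (a b : SpaceTime) : ContDiffAt ℝ ∞ (fun w => pullbackMetric g u futureHalf w a b) z :=
  (contDiffOn_pullbackMetric g uniqueDiffOn_futureHalf hu a b).contDiffAt (futureHalf_mem_nhds hz)

/-- The product rule along the line `z + s • c`, in the fixed chart at `u z`. The result has the
shape of the hypothesis `hD` of `stress_energy_algebra`. -/
theorem dirDeriv_pullbackMetric_eq_chart (g : SmoothMetric n M)
    (hu : ContMDiffOn 𝓘(ℝ, SpaceTime) (𝓡 n) ∞ u futureHalf) {z : SpaceTime} (hz : 0 < z.1)
    {φ : OpenPartialHomeomorph M (Euc n)} (hφ : φ = chartAt (Euc n) (u z)) (c a b : SpaceTime) :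
    dirDeriv c (fun w => pullbackMetric g u futureHalf w a b) z =
      ∑ k, ∑ l, ((∑ m, metricDeriv g φ (φ (u z)) m k l * dirDeriv c (fun w => φ (u w) m) z) *
          dirDeriv a (fun w => φ (u w) k) z * dirDeriv b (fun w => φ (u w) l) z +
        metricMatrix g φ (φ (u z)) k l * dirDeriv c (dirDeriv a (fun w => φ (u w) k)) z *
          dirDeriv b (fun w => φ (u w) l) z +
        metricMatrix g φ (φ (u z)) k l * dirDeriv a (fun w => φ (u w) k) z *
          dirDeriv c (dirDeriv b (fun w => φ (u w) l)) z) := by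
  subst hφ
  set φ := chartAt (Euc n) (u z) with hφ
  have hsrc : u z ∈ φ.source := mem_chart_source _ _
  have huat : ∀ w : SpaceTime, 0 < w.1 → ContMDiffAt 𝓘(ℝ, SpaceTime) (𝓡 n) ∞ u w :=
    fun w hw => hu.contMDiffAt (futureHalf_mem_nhds hw)
  have hv := contDiffAt_chart_comp (u z) (huat z hz) hsrc
  have hvk : ∀ k, ContDiffAt ℝ ∞ (fun w => φ (u w) k) z := fun k =>
    (EuclideanSpace.proj (𝕜 := ℝ) k).contDiff.contDiffAt.comp z hv
  have hy : φ (u z) ∈ φ.target := φ.map_source hsrc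
  have hG : ∀ k l, HasDerivAt (fun s : ℝ => metricMatrix g φ (φ (u (z + s • c))) k l)
      (∑ m, metricDeriv g φ (φ (u z)) m k l * dirDeriv c (fun w => φ (u w) m) z) 0 := by
    intro k l
    have hGd := ((contDiffAt_metricMatrix g (u z) hy k l).differentiableAt (by simp)).hasFDerivAt
    have hcomp : HasFDerivAt (fun w => metricMatrix g φ (φ (u w)) k l)
        ((fderiv ℝ (fun y => metricMatrix g φ y k l) (φ (u z))).comp
          (fderiv ℝ (fun w => φ (u w)) z)) z :=
      HasFDerivAt.comp (g := fun y => metricMatrix g φ y k l) (f := fun w => φ (u w)) z hGd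
        (hv.differentiableAt (by simp)).hasFDerivAt
    have h := hasDerivAt_dirDeriv hcomp.differentiableAt c
    convert! h using 1
    rw [dirDeriv, hcomp.fderiv, ContinuousLinearMap.comp_apply]
    conv_rhs => rw [euclideanSpace_eq_sum_single (fderiv ℝ (fun w => φ (u w)) z c), map_sum]
    refine Finset.sum_congr rfl fun m _ => ?_
    rw [map_smul, smul_eq_mul, mul_comm, dirDeriv_coord (hv.differentiableAt (by simp))]
    rfl
  have h1 := hasDerivAt_dirDeriv ((contDiffAt_pullbackMetric g hu hz a b).differentiableAt
    (by simp)) c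
  refine h1.unique ?_
  have h2 : HasDerivAt (fun s : ℝ => ∑ k, ∑ l, metricMatrix g φ (φ (u (z + s • c))) k l *
      dirDeriv a (fun w => φ (u w) k) (z + s • c) * dirDeriv b (fun w => φ (u w) l) (z + s • c))
      (∑ k, ∑ l, ((∑ m, metricDeriv g φ (φ (u z)) m k l * dirDeriv c (fun w => φ (u w) m) z) *
          dirDeriv a (fun w => φ (u w) k) z * dirDeriv b (fun w => φ (u w) l) z +
        metricMatrix g φ (φ (u z)) k l * dirDeriv c (dirDeriv a (fun w => φ (u w) k)) z *
          dirDeriv b (fun w => φ (u w) l) z +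
        metricMatrix g φ (φ (u z)) k l * dirDeriv a (fun w => φ (u w) k) z *
          dirDeriv c (dirDeriv b (fun w => φ (u w) l)) z)) 0 := by
    refine HasDerivAt.fun_sum fun k _ => HasDerivAt.fun_sum fun l _ => ?_
    have ha := hasDerivAt_dirDeriv ((contDiffAt_dirDeriv (hvk k) a).differentiableAt (by simp)) c
    have hb := hasDerivAt_dirDeriv ((contDiffAt_dirDeriv (hvk l) b).differentiableAt (by simp)) c
    convert! ((hG k l).mul ha).mul hb using 1
    simp only [zero_smul, add_zero, Pi.mul_apply]
    ring
  refine h2.congr_of_eventuallyEq ?_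
  have hline : Tendsto (fun s : ℝ => z + s • c) (𝓝 0) (𝓝 z) := by
    have : Continuous fun s : ℝ => z + s • c := by fun_prop
    simpa using this.tendsto 0
  have hev : ∀ᶠ w in 𝓝 z, 0 < w.1 ∧ u w ∈ φ.source :=
    (continuous_fst.continuousAt.eventually (lt_mem_nhds hz)).and
      ((huat z hz).continuousAt (φ.open_source.mem_nhds hsrc))
  filter_upwards [hline.eventually hev] with s hs
  exact pullbackMetric_eq_chart g (u z) (huat _ hs.1) hs.1 hs.2 a b

/-- The stress-energy tensor of a wave map is divergence free. -/
theorem IsGlobalWaveMap.stress_energy {g : SmoothMetric n M} (hwave : IsGlobalWaveMap g u)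
    {z : SpaceTime} (hz : 0 < z.1) (b : Fin 3) :
    ∑ a, minkowskiSign a *
      (dirDeriv (coordDir a)
          (fun w => pullbackMetric g u futureHalf w (coordDir a) (coordDir b)) z -
        1 / 2 * dirDeriv (coordDir b)
          (fun w => pullbackMetric g u futureHalf w (coordDir a) (coordDir a)) z) = 0 := by
  set φ := chartAt (Euc n) (u z) with hφ
  have hsrc : u z ∈ φ.source := mem_chart_source _ _
  have hy : φ (u z) ∈ φ.target := φ.map_source hsrc
  have hv := contDiffAt_chart_comp (u z) (hwave.smooth.contMDiffAt (futureHalf_mem_nhds hz)) hsrc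
  have hvk : ∀ k, ContDiffAt ℝ ∞ (fun w => φ (u w) k) z := fun k =>
    (EuclideanSpace.proj (𝕜 := ℝ) k).contDiff.contDiffAt.comp z hv
  refine stress_energy_algebra minkowskiSign (metricMatrix g φ (φ (u z)))
    (metricDeriv g φ (φ (u z))) (fun a k => dirDeriv (coordDir a) (fun w => φ (u w) k) z)
    (fun c a k => dirDeriv (coordDir c) (dirDeriv (coordDir a) (fun w => φ (u w) k)) z)
    (isUnit_metricMatrix g _ hy) (metricMatrix_symm g _ _) ?_
    (fun a b k => dirDeriv_comm (hvk k) _ _) ?_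
    (fun c a b => dirDeriv (coordDir c)
      (fun w => pullbackMetric g u futureHalf w (coordDir a) (coordDir b)) z)
    (fun c a b => dirDeriv_pullbackMetric_eq_chart g hwave.smooth hz hφ _ _ _) b
  · intro m k l
    have h : (fun y => metricMatrix g φ y k l) = fun y => metricMatrix g φ y l k :=
      funext fun y => metricMatrix_symm g (u z) y k l
    exact congrArg (fun F => fderiv ℝ F (φ (u z)) (EuclideanSpace.single m 1)) h
  · intro i
    have h := hwave.equation z hz φ (IsManifold.chart_mem_maximalAtlas _) hsrc i
    simp only [waveOp, nullForm, christoffel, Fin.sum_univ_two] at h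
    simp only [Fin.sum_univ_three, coordDir, minkowskiSign, Matrix.cons_val_zero,
      Matrix.cons_val_one, Matrix.cons_val_two, Matrix.head_cons,
      Matrix.tail_cons]
    refine Eq.trans (by ring) (h.trans ?_)
    refine Finset.sum_congr rfl fun k _ => Finset.sum_congr rfl fun l _ => ?_
    congr 1
    ring

end StressEnergy

/-! ### Rotations of space and equivariance -/

section Rotation

open Set Filter Topology

/-- The rotation of space by the angle `s`. -/
noncomputable def rot (s : ℝ) : SpaceTime →L[ℝ] SpaceTime :=
  LinearMap.toContinuousLinearMap
    { toFun := fun z => (z.1, !₂[Real.cos s * z.2 0 - Real.sin s * z.2 1,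
        Real.sin s * z.2 0 + Real.cos s * z.2 1])
      map_add' := fun z w => by
        ext i
        · simp
        · fin_cases i <;> simp <;> ring
      map_smul' := fun c z => by
        ext i
        · simp
        · fin_cases i <;> simp <;> ring }

theorem rot_apply (s : ℝ) (z : SpaceTime) :
    rot s z = (z.1, !₂[Real.cos s * z.2 0 - Real.sin s * z.2 1,
      Real.sin s * z.2 0 + Real.cos s * z.2 1]) := rfl

/-- The generator of the rotations of space. -/
noncomputable def rotGen (z : SpaceTime) : SpaceTime := (0, !₂[-z.2 1, z.2 0])

theorem rot_timeDir (s : ℝ) : rot s timeDir = timeDir := by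
  ext i
  · simp [rot_apply, timeDir]
  · fin_cases i <;> simp [rot_apply, timeDir]

theorem rot_spaceDir_zero (s : ℝ) :
    rot s (spaceDir 0) = Real.cos s • spaceDir 0 + Real.sin s • spaceDir 1 := by
  ext i
  · simp [rot_apply, spaceDir]
  · fin_cases i <;> simp [rot_apply, spaceDir]

theorem rot_spaceDir_one (s : ℝ) :
    rot s (spaceDir 1) = (-Real.sin s) • spaceDir 0 + Real.cos s • spaceDir 1 := by
  ext i
  · simp [rot_apply, spaceDir]
  · fin_cases i <;> simp [rot_apply, spaceDir]

theorem rot_neg_rot (s : ℝ) (z : SpaceTime) : rot (-s) (rot s z) = z := by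
  ext i
  · simp [rot_apply]
  · fin_cases i
    · simp [rot_apply]
      linear_combination z.2 0 * Real.sin_sq_add_cos_sq s
    · simp [rot_apply]
      linear_combination z.2 1 * Real.sin_sq_add_cos_sq s

theorem rot_polarPoint (s t r θ : ℝ) :
    rot s (t, polarPoint r θ) = (t, polarPoint r (θ + s)) := by
  ext i
  · simp [rot_apply]
  · fin_cases i
    · simp [rot_apply, polarPoint, Real.cos_add]
      ring
    · simp [rot_apply, polarPoint, Real.sin_add]
      ring

theorem exists_eq_polarPoint (x : Euc 2) : ∃ θ, x = polarPoint ‖x‖ θ := by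
  have hn : ‖x‖ = ‖(⟨x 0, x 1⟩ : ℂ)‖ := by
    rw [EuclideanSpace.norm_eq, Complex.norm_eq_sqrt_sq_add_sq]
    simp
  refine ⟨Complex.arg ⟨x 0, x 1⟩, ?_⟩
  rw [hn]
  ext i
  fin_cases i
  · simp [polarPoint, Complex.norm_mul_cos_arg]
  · simp [polarPoint, Complex.norm_mul_sin_arg]

theorem hasDerivAt_rot (z : SpaceTime) : HasDerivAt (fun s => rot s z) (rotGen z) 0 := by
  have h : (fun s => rot s z) = fun s => (z - (0, z.2)) + Real.cos s • (0, z.2) +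
      Real.sin s • rotGen z := by
    funext s
    ext i
    · simp [rot_apply, rotGen]
    · fin_cases i <;> simp [rot_apply, rotGen] <;> ring
  rw [h]
  have h1 := ((Real.hasDerivAt_cos 0).smul_const ((0, z.2) : SpaceTime)).const_add (z - (0, z.2))
  have h2 := (Real.hasDerivAt_sin 0).smul_const (rotGen z)
  simpa using! h1.add h2

variable {n : ℕ} {M : Type*} [TopologicalSpace M] [ChartedSpace (Euc n) M] {u : SpaceTime → M}

/-- The family `Φ` of diffeomorphisms describes the behaviour of `u` under rotations. -/
def IsRotationEquivariant (u : SpaceTime → M)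
    (Φ : ℝ → Diffeomorph (𝓡 n) (𝓡 n) M M ∞) : Prop :=
  ∀ z ∈ futureHalf, z.2 ≠ 0 → ∀ s, u (rot s z) = Φ s (u z)

theorem isRotationEquivariant_of_polar {Φ : ℝ → Diffeomorph (𝓡 n) (𝓡 n) M M ∞}
    (h : ∀ t r θ s : ℝ, 0 ≤ t → 0 < r →
      u (t, polarPoint r (θ + s)) = Φ s (u (t, polarPoint r θ))) :
    IsRotationEquivariant u Φ := by
  rintro ⟨t, x⟩ hz hx s
  obtain ⟨θ, hθ⟩ := exists_eq_polarPoint x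
  rw [hθ, rot_polarPoint]
  exact h t _ θ s hz (norm_pos_iff.2 hx)

variable [IsManifold (𝓡 n) ∞ M]

/-- Differentiate `u ∘ rot s = Φ s ∘ u` near `z`, where the identity holds because `z` is off the
axis; the isometry `Φ s` then drops out of the inner product. -/
theorem pullbackMetric_rot {g : SmoothMetric n M} {Φ : ℝ → Diffeomorph (𝓡 n) (𝓡 n) M M ∞}
    (hu : ContMDiffOn 𝓘(ℝ, SpaceTime) (𝓡 n) ∞ u futureHalf)
    (hiso : ∀ s, IsRiemannianIsometry g (Φ s)) (hΦ : IsRotationEquivariant u Φ)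
    {z : SpaceTime} (hz : z ∈ futureHalf) (hz2 : z.2 ≠ 0) (s : ℝ) (a b : SpaceTime) :
    pullbackMetric g u futureHalf (rot s z) (rot s a) (rot s b) =
      pullbackMetric g u futureHalf z a b := by
  have hmaps : MapsTo (rot s) futureHalf futureHalf := fun w hw => hw
  have huniq := (uniqueDiffOn_futureHalf.uniqueMDiffOn) z hz
  have hud : ∀ w ∈ futureHalf, MDifferentiableWithinAt 𝓘(ℝ, SpaceTime) (𝓡 n) u futureHalf w :=
    fun w hw => (hu w hw).mdifferentiableWithinAt (by simp)
  have hrot : MDifferentiableWithinAt 𝓘(ℝ, SpaceTime) 𝓘(ℝ, SpaceTime) (rot s) futureHalf z :=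
    (rot s).differentiableAt.differentiableWithinAt.mdifferentiableWithinAt
  have h1 := mfderivWithin_comp z (hud _ (hmaps hz)) hrot hmaps huniq
  have h2 := mfderiv_comp_mfderivWithin z
    (((Φ s).contMDiff.mdifferentiable (by simp)) (u z)) (hud z hz) huniq
  have hev : u ∘ rot s =ᶠ[𝓝[futureHalf] z] Φ s ∘ u := by
    have h0 : ∀ᶠ w : SpaceTime in 𝓝[futureHalf] z, w.2 ≠ 0 :=
      (continuous_snd.continuousAt.eventually_ne hz2).filter_mono nhdsWithin_le_nhds
    filter_upwards [h0, self_mem_nhdsWithin] with w hw hw'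
    exact hΦ w hw' hw s
  have h3 := hev.mfderivWithin_eq (I := 𝓘(ℝ, SpaceTime)) (I' := 𝓡 n) (hΦ z hz hz2 s)
  have hrotd : mfderivWithin 𝓘(ℝ, SpaceTime) 𝓘(ℝ, SpaceTime) (rot s) futureHalf z = rot s := by
    rw [mfderivWithin_eq_fderivWithin, (rot s).fderivWithin (uniqueDiffOn_futureHalf z hz)]
  rw [h1, h2, hrotd] at h3
  have h4 : ∀ a : SpaceTime,
      (mfderivWithin 𝓘(ℝ, SpaceTime) (𝓡 n) u futureHalf (rot s z) (rot s a) : Euc n) =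
      mfderiv (𝓡 n) (𝓡 n) (Φ s) (u z) (mfderivWithin 𝓘(ℝ, SpaceTime) (𝓡 n) u futureHalf z a) :=
    fun a => congrArg (fun L : SpaceTime →L[ℝ] Euc n => L a) h3
  let F : M → Euc n → Euc n → ℝ := fun p x y =>
    g.inner p (show TangentSpace (𝓡 n) p from x) (show TangentSpace (𝓡 n) p from y)
  refine Eq.trans ?_ (hiso s (u z) (mfderivWithin 𝓘(ℝ, SpaceTime) (𝓡 n) u futureHalf z a)
    (mfderivWithin 𝓘(ℝ, SpaceTime) (𝓡 n) u futureHalf z b))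
  change F (u (rot s z)) _ _ = F (Φ s (u z)) _ _
  rw [hΦ z hz hz2 s]
  exact congrArg₂ (F (Φ s (u z))) (h4 a) (h4 b)

end Rotation

/-! ### The generator of the isometries and the angular derivative -/

section Killing

set_option maxSynthPendingDepth 3

open Set Filter Topology

/-- A continuous bilinear form that is positive at `y₀` is locally uniformly coercive. -/
theorem exists_coercive_nhds {X E : Type*} [TopologicalSpace X] [NormedAddCommGroup E]
    [NormedSpace ℝ E] [FiniteDimensional ℝ E] {B : X → E →L[ℝ] E →L[ℝ] ℝ} {y₀ : X}
    (hB : ContinuousAt B y₀) (hpos : ∀ a, a ≠ 0 → 0 < B y₀ a a) :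
    ∃ c > 0, ∀ᶠ y in 𝓝 y₀, ∀ a, c * ‖a‖ ^ 2 ≤ B y a a := by
  have hcont : ContinuousOn (fun a => B y₀ a a) (Metric.sphere (0 : E) 1) := by fun_prop
  obtain ⟨c, hc, hle⟩ := (isCompact_sphere (0 : E) 1).exists_forall_le' hcont (a := 0)
    fun a ha => hpos a (norm_ne_zero_iff.1 (by simp [mem_sphere_zero_iff_norm.1 ha]))
  have h0 : ∀ a, c * ‖a‖ ^ 2 ≤ B y₀ a a := by
    intro a
    by_cases ha : a = 0
    · simp [ha]
    · have hn : ‖a‖ ≠ 0 := norm_ne_zero_iff.2 ha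
      have h := hle (‖a‖⁻¹ • a) (by simp [norm_smul, hn])
      simp only [map_smul, smul_apply, smul_eq_mul] at h
      have : B y₀ a a = ‖a‖ ^ 2 * (‖a‖⁻¹ * (‖a‖⁻¹ * B y₀ a a)) := by field_simp
      rw [this, mul_comm c]
      exact mul_le_mul_of_nonneg_left h (sq_nonneg _)
  refine ⟨c / 2, half_pos hc, ?_⟩
  filter_upwards [Metric.continuousAt_iff'.1 hB (c / 2) (half_pos hc)] with y hy a
  rw [dist_eq_norm] at hy
  have h1 := (B y - B y₀).le_opNorm₂ a a
  rw [sub_apply, sub_apply, Real.norm_eq_abs] at h1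
  have h2 := (abs_le.1 h1).1
  have h3 : ‖B y - B y₀‖ * ‖a‖ * ‖a‖ ≤ c / 2 * ‖a‖ ^ 2 := by
    rw [mul_assoc, ← sq]
    exact mul_le_mul_of_nonneg_right hy.le (sq_nonneg _)
  have h4 := h0 a
  linarith

/-- The derivative of the squared length of a `C¹` vector field is locally bounded by the length of
the field. -/
theorem exists_fderiv_sq_length_le {E : Type*} [NormedAddCommGroup E]
    [NormedSpace ℝ E] [FiniteDimensional ℝ E] {B : E → E →L[ℝ] E →L[ℝ] ℝ} {X : E → E} {y₀ : E}
    (hB : ContDiffAt ℝ 1 B y₀) (hX : ContDiffAt ℝ 1 X y₀) (hpos : ∀ a, a ≠ 0 → 0 < B y₀ a a) :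
    ∃ C ≥ 0, ∀ᶠ y in 𝓝 y₀, DifferentiableAt ℝ (fun y => B y (X y) (X y)) y ∧
      ∀ a, |fderiv ℝ (fun y => B y (X y) (X y)) y a| ≤ C * √(B y a a) * √(B y (X y) (X y)) := by
  obtain ⟨c, hc, hcoer⟩ := exists_coercive_nhds hB.continuousAt hpos
  have hcont : ContinuousAt
      (fun y => ‖fderiv ℝ B y‖ * ‖X y‖ + 2 * (‖B y‖ * ‖fderiv ℝ X y‖)) y₀ := by
    have h1 := (hB.fderiv_right (m := 0) (by simp)).continuousAt
    have h2 := (hX.fderiv_right (m := 0) (by simp)).continuousAt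
    exact (h1.norm.mul hX.continuousAt.norm).add
      ((hB.continuousAt.norm.mul h2.norm).const_mul 2)
  -- Each term of the derivative of `B(X, X)` in direction `a` contains a factor `‖a‖ * ‖X‖`. The
  -- coefficient stays below `K + 1` near `y₀`, and coercivity turns each of the two norms into a
  -- `B`-length at the cost of `1 / √c`.
  set K := ‖fderiv ℝ B y₀‖ * ‖X y₀‖ + 2 * (‖B y₀‖ * ‖fderiv ℝ X y₀‖) with hK
  have hK0 : 0 ≤ K := by positivity
  refine ⟨(K + 1) / c, by positivity, ?_⟩
  filter_upwards [hcoer, hcont.eventually (gt_mem_nhds (lt_add_one K)),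
    hB.eventually (by simp), hX.eventually (by simp)] with y hy hyK hyB hyX
  have hdB := (hyB.differentiableAt one_ne_zero).hasFDerivAt
  have hdX := (hyX.differentiableAt one_ne_zero).hasFDerivAt
  have hd := (hdB.clm_apply hdX).clm_apply hdX
  refine ⟨hd.differentiableAt, fun a => ?_⟩
  have hsq : ∀ b, ‖b‖ ≤ √(B y b b) / √c := by
    intro b
    rw [le_div_iff₀ (Real.sqrt_pos.2 hc)]
    refine Real.le_sqrt_of_sq_le ?_
    rw [mul_pow, Real.sq_sqrt hc.le, mul_comm]
    exact hy b
  have hval : fderiv ℝ (fun y => B y (X y) (X y)) y a =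
      fderiv ℝ B y a (X y) (X y) + B y (fderiv ℝ X y a) (X y) + B y (X y) (fderiv ℝ X y a) := by
    rw [hd.fderiv]
    simp
    ring
  rw [hval]
  have e1 : |fderiv ℝ B y a (X y) (X y)| ≤ ‖fderiv ℝ B y‖ * ‖a‖ * ‖X y‖ * ‖X y‖ := by
    refine ((fderiv ℝ B y a).le_opNorm₂ _ _).trans ?_
    gcongr
    exact (fderiv ℝ B y).le_opNorm a
  have e2 : |B y (fderiv ℝ X y a) (X y)| ≤ ‖B y‖ * (‖fderiv ℝ X y‖ * ‖a‖) * ‖X y‖ := by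
    refine ((B y).le_opNorm₂ _ _).trans ?_
    gcongr
    exact (fderiv ℝ X y).le_opNorm a
  have e3 : |B y (X y) (fderiv ℝ X y a)| ≤ ‖B y‖ * ‖X y‖ * (‖fderiv ℝ X y‖ * ‖a‖) := by
    refine ((B y).le_opNorm₂ _ _).trans ?_
    gcongr
    exact (fderiv ℝ X y).le_opNorm a
  calc _ ≤ |fderiv ℝ B y a (X y) (X y)| + |B y (fderiv ℝ X y a) (X y)| +
        |B y (X y) (fderiv ℝ X y a)| := abs_add_three _ _ _
    _ ≤ (‖fderiv ℝ B y‖ * ‖X y‖ + 2 * (‖B y‖ * ‖fderiv ℝ X y‖)) * (‖a‖ * ‖X y‖) := by linarith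
    _ ≤ (K + 1) * (√(B y a a) / √c * (√(B y (X y) (X y)) / √c)) := by
        gcongr
        · exact hsq a
        · exact hsq (X y)
    _ = _ := by
        have := Real.mul_self_sqrt hc.le
        have h0 : √c ≠ 0 := (Real.sqrt_pos.2 hc).ne'
        rw [← this]
        field_simp
        rw [Real.sqrt_sq (Real.sqrt_nonneg _)]

variable {n : ℕ} {M : Type*} [TopologicalSpace M] [ChartedSpace (Euc n) M]
  [IsManifold (𝓡 n) ∞ M] {u : SpaceTime → M}

/-- The metric in the chart at `p₀` as a bilinear form depending on the coordinates. -/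
noncomputable def chartMetric (g : SmoothMetric n M) (p₀ : M) (y : Euc n) :
    Euc n →L[ℝ] Euc n →L[ℝ] ℝ :=
  ∑ k, ∑ l, metricMatrix g (chartAt (Euc n) p₀) y k l •
    (EuclideanSpace.proj (𝕜 := ℝ) k : Euc n →L[ℝ] ℝ).smulRight
      (EuclideanSpace.proj (𝕜 := ℝ) l : Euc n →L[ℝ] ℝ)

theorem chartMetric_apply (g : SmoothMetric n M) (p₀ : M) (y a b : Euc n) :
    chartMetric g p₀ y a b =
      ∑ k, ∑ l, metricMatrix g (chartAt (Euc n) p₀) y k l * a k * b l := by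
  simp [chartMetric, sum_apply, mul_assoc]

theorem contDiffAt_chartMetric (g : SmoothMetric n M) (p₀ : M) {y : Euc n}
    (hy : y ∈ (chartAt (Euc n) p₀).target) : ContDiffAt ℝ ∞ (chartMetric g p₀) y :=
  ContDiffAt.sum fun k _ => ContDiffAt.sum fun l _ =>
    (contDiffAt_metricMatrix g p₀ hy k l).smul contDiffAt_const

/-- The family `Φ` in the chart at `p₀`. -/
noncomputable def chartFlow (Φ : ℝ → Diffeomorph (𝓡 n) (𝓡 n) M M ∞) (p₀ : M)
    (q : ℝ × Euc n) : Euc n :=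
  chartAt (Euc n) p₀ (Φ q.1 ((chartAt (Euc n) p₀).symm q.2))

/-- The generator of the family `Φ` in the chart at `p₀`. -/
noncomputable def chartGenerator (Φ : ℝ → Diffeomorph (𝓡 n) (𝓡 n) M M ∞) (p₀ : M)
    (y : Euc n) : Euc n :=
  fderiv ℝ (chartFlow Φ p₀) (0, y) (1, 0)

theorem contDiffAt_chartFlow {Φ : ℝ → Diffeomorph (𝓡 n) (𝓡 n) M M ∞}
    (hΦ : ContMDiff (𝓘(ℝ, ℝ).prod (𝓡 n)) (𝓡 n) ∞ (fun q : ℝ × M => Φ q.1 q.2))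
    (hΦ0 : ∀ p, Φ 0 p = p) (p₀ : M) {y : Euc n} (hy : y ∈ (chartAt (Euc n) p₀).target) :
    ContDiffAt ℝ ∞ (chartFlow Φ p₀) (0, y) := by
  set φ := chartAt (Euc n) p₀ with hφ
  have h1 : ContMDiffAt 𝓘(ℝ, ℝ × Euc n) (𝓡 n) ∞ (fun q : ℝ × Euc n => φ.symm q.2) (0, y) := by
    have := (contMDiffOn_chartAt_symm (n := n) p₀).contMDiffAt (φ.open_target.mem_nhds hy)
    exact ContMDiffAt.comp (g := φ.symm) (f := fun q : ℝ × Euc n => q.2) (0, y) this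
      contDiff_snd.contMDiff.contMDiffAt
  have h2 : ContMDiffAt 𝓘(ℝ, ℝ × Euc n) 𝓘(ℝ, ℝ) ∞ (fun q : ℝ × Euc n => q.1) (0, y) :=
    contDiff_fst.contMDiff.contMDiffAt
  have h3 : ContMDiffAt 𝓘(ℝ, ℝ × Euc n) (𝓡 n) ∞
      (fun q : ℝ × Euc n => Φ q.1 (φ.symm q.2)) (0, y) :=
    ContMDiffAt.comp (g := fun q : ℝ × M => Φ q.1 q.2)
      (f := fun q : ℝ × Euc n => (q.1, φ.symm q.2)) (0, y) hΦ.contMDiffAt (h2.prodMk h1)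
  have h4 : ContMDiffAt (𝓡 n) (𝓡 n) ∞ φ (Φ 0 (φ.symm y)) := by
    rw [hΦ0]
    exact (contMDiffOn_chart (I := 𝓡 n) (x := p₀)).contMDiffAt
      (φ.open_source.mem_nhds (φ.map_target hy))
  exact (ContMDiffAt.comp (g := φ) (f := fun q : ℝ × Euc n => Φ q.1 (φ.symm q.2)) (0, y) h4
    h3).contDiffAt

theorem contDiffAt_chartGenerator {Φ : ℝ → Diffeomorph (𝓡 n) (𝓡 n) M M ∞}
    (hΦ : ContMDiff (𝓘(ℝ, ℝ).prod (𝓡 n)) (𝓡 n) ∞ (fun q : ℝ × M => Φ q.1 q.2))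
    (hΦ0 : ∀ p, Φ 0 p = p) (p₀ : M) {y : Euc n} (hy : y ∈ (chartAt (Euc n) p₀).target) :
    ContDiffAt ℝ ∞ (chartGenerator Φ p₀) y := by
  have h1 : ContDiffAt ℝ ∞ (fun q => fderiv ℝ (chartFlow Φ p₀) q (1, 0)) (0, y) :=
    ((contDiffAt_chartFlow hΦ hΦ0 p₀ hy).fderiv_right (m := ∞) (by simp)).clm_apply
      contDiffAt_const
  exact ContDiffAt.comp (g := fun q => fderiv ℝ (chartFlow Φ p₀) q (1, 0))
    (f := fun y : Euc n => ((0 : ℝ), y)) y h1 (contDiffAt_const.prodMk contDiffAt_id)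

/-- In the chart this is `∂_θ u = X(u)`: the equivariance relation is differentiated in the angle at
`s = 0`. -/
theorem fderiv_chart_rotGen {Φ : ℝ → Diffeomorph (𝓡 n) (𝓡 n) M M ∞}
    (hΦ : ContMDiff (𝓘(ℝ, ℝ).prod (𝓡 n)) (𝓡 n) ∞ (fun q : ℝ × M => Φ q.1 q.2))
    (hΦ0 : ∀ p, Φ 0 p = p) (hsym : IsRotationEquivariant u Φ) (p₀ : M) {z : SpaceTime}
    (hu : ContMDiffAt 𝓘(ℝ, SpaceTime) (𝓡 n) ∞ u z) (hz : 0 < z.1) (hz2 : z.2 ≠ 0)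
    (hsrc : u z ∈ (chartAt (Euc n) p₀).source) :
    fderiv ℝ (fun w => chartAt (Euc n) p₀ (u w)) z (rotGen z) =
      chartGenerator Φ p₀ (chartAt (Euc n) p₀ (u z)) := by
  set φ := chartAt (Euc n) p₀ with hφ
  have hr0 : rot 0 z = z := by
    ext i
    · simp [rot_apply]
    · fin_cases i <;> simp [rot_apply]
  have hv : HasFDerivAt (fun w => φ (u w)) (fderiv ℝ (fun w => φ (u w)) z) (rot 0 z) := by
    rw [hr0]
    exact ((contDiffAt_chart_comp p₀ hu hsrc).differentiableAt (by simp)).hasFDerivAt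
  have h1 := hv.comp_hasDerivAt 0 (hasDerivAt_rot z)
  have hY := ((contDiffAt_chartFlow hΦ hΦ0 p₀ (φ.map_source hsrc)).differentiableAt
    (by simp)).hasFDerivAt
  have h2 := HasFDerivAt.comp_hasDerivAt (f := fun s : ℝ => (s, φ (u z))) 0 hY
    ((hasDerivAt_id 0).prodMk (hasDerivAt_const (0 : ℝ) (φ (u z))))
  refine h1.unique (h2.congr_of_eventuallyEq (Eventually.of_forall fun s => ?_))
  simp only [Function.comp_apply, chartFlow]
  rw [φ.left_inv hsrc, hsym z (show (0 : ℝ) ≤ z.1 from hz.le) hz2 s]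

/-- Near `z` the function is `|X|²` composed with `u`, so `exists_fderiv_sq_length_le` applies with
`a` pushed forward by `u`. The constant depends on a neighbourhood in the target only, not on `z`.
-/
theorem exists_dirDeriv_angular_le_nhds (g : SmoothMetric n M)
    {Φ : ℝ → Diffeomorph (𝓡 n) (𝓡 n) M M ∞}
    (hΦ : ContMDiff (𝓘(ℝ, ℝ).prod (𝓡 n)) (𝓡 n) ∞ (fun q : ℝ × M => Φ q.1 q.2))
    (hΦ0 : ∀ p, Φ 0 p = p) (hu : ContMDiffOn 𝓘(ℝ, SpaceTime) (𝓡 n) ∞ u futureHalf)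
    (hsym : IsRotationEquivariant u Φ) (p₀ : M) :
    ∃ C ≥ 0, ∀ᶠ p in 𝓝 p₀, ∀ z : SpaceTime, u z = p → 0 < z.1 → z.2 ≠ 0 → ∀ a,
      |dirDeriv a (fun w => pullbackMetric g u futureHalf w (rotGen w) (rotGen w)) z| ≤
        C * √(pullbackMetric g u futureHalf z a a) *
          √(pullbackMetric g u futureHalf z (rotGen z) (rotGen z)) := by
  set φ := chartAt (Euc n) p₀ with hφ
  have hsrc₀ : p₀ ∈ φ.source := mem_chart_source _ _
  have hy₀ := φ.map_source hsrc₀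
  obtain ⟨C, hC, hev⟩ := exists_fderiv_sq_length_le
    ((contDiffAt_chartMetric g p₀ hy₀).of_le (by norm_cast))
    ((contDiffAt_chartGenerator hΦ hΦ0 p₀ hy₀).of_le (by norm_cast))
    (fun a ha => by
      rw [chartMetric_apply]
      exact metricMatrix_pos g p₀ hy₀ ha)
  refine ⟨C, hC, ?_⟩
  filter_upwards [(φ.continuousAt hsrc₀).eventually hev, φ.open_source.mem_nhds hsrc₀]
    with p hp hsrc z hzp hz hz2 a
  subst hzp
  have huat : ∀ w : SpaceTime, 0 < w.1 → ContMDiffAt 𝓘(ℝ, SpaceTime) (𝓡 n) ∞ u w :=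
    fun w hw => hu.contMDiffAt (futureHalf_mem_nhds hw)
  have hrep : ∀ w : SpaceTime, 0 < w.1 → u w ∈ φ.source → ∀ b,
      pullbackMetric g u futureHalf w b b = chartMetric g p₀ (φ (u w))
        (fderiv ℝ (fun w => φ (u w)) w b) (fderiv ℝ (fun w => φ (u w)) w b) := by
    intro w hw hws b
    have hd := (contDiffAt_chart_comp p₀ (huat w hw) hws).differentiableAt (by simp)
    rw [pullbackMetric_eq_chart g p₀ (huat w hw) hw hws, chartMetric_apply]
    simp only [dirDeriv_coord hd]
    rfl
  have hrepW : ∀ w : SpaceTime, 0 < w.1 → w.2 ≠ 0 → u w ∈ φ.source →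
      pullbackMetric g u futureHalf w (rotGen w) (rotGen w) = chartMetric g p₀ (φ (u w))
        (chartGenerator Φ p₀ (φ (u w))) (chartGenerator Φ p₀ (φ (u w))) := by
    intro w hw hw2 hws
    rw [hrep w hw hws, fderiv_chart_rotGen hΦ hΦ0 hsym p₀ (huat w hw) hw hw2 hws]
  have hloc : (fun w => pullbackMetric g u futureHalf w (rotGen w) (rotGen w)) =ᶠ[𝓝 z]
      fun w => chartMetric g p₀ (φ (u w))
        (chartGenerator Φ p₀ (φ (u w))) (chartGenerator Φ p₀ (φ (u w))) := by
    filter_upwards [continuous_fst.continuousAt.eventually (lt_mem_nhds hz),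
      continuous_snd.continuousAt.eventually_ne hz2,
      (huat z hz).continuousAt (φ.open_source.mem_nhds hsrc)] with w h1 h2 h3
    exact hrepW w h1 h2 h3
  have hd := (contDiffAt_chart_comp p₀ (huat z hz) hsrc).differentiableAt (by simp)
  have hcomp := HasFDerivAt.comp
    (g := fun y => chartMetric g p₀ y (chartGenerator Φ p₀ y) (chartGenerator Φ p₀ y))
    (f := fun w => φ (u w)) z hp.1.hasFDerivAt hd.hasFDerivAt
  rw [dirDeriv, hloc.fderiv_eq, hrepW z hz hz2 hsrc, hrep z hz hsrc]
  have hfd : fderiv ℝ (fun w => chartMetric g p₀ (φ (u w))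
      (chartGenerator Φ p₀ (φ (u w))) (chartGenerator Φ p₀ (φ (u w)))) z = _ := hcomp.fderiv
  rw [hfd]
  exact hp.2 _

/-- The squared length of the angular derivative of a quasi-equivariant map is the squared length
of a vector field on the target, whence a bound for its derivatives. -/
theorem exists_dirDeriv_angular_le [CompactSpace M] (g : SmoothMetric n M)
    {Φ : ℝ → Diffeomorph (𝓡 n) (𝓡 n) M M ∞}
    (hΦ : ContMDiff (𝓘(ℝ, ℝ).prod (𝓡 n)) (𝓡 n) ∞ (fun q : ℝ × M => Φ q.1 q.2))
    (hΦ0 : ∀ p, Φ 0 p = p) (hu : ContMDiffOn 𝓘(ℝ, SpaceTime) (𝓡 n) ∞ u futureHalf)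
    (hsym : IsRotationEquivariant u Φ) :
    ∃ C ≥ 0, ∀ z : SpaceTime, 0 < z.1 → z.2 ≠ 0 → ∀ a,
      |dirDeriv a (fun w => pullbackMetric g u futureHalf w (rotGen w) (rotGen w)) z| ≤
        C * √(pullbackMetric g u futureHalf z a a) *
          √(pullbackMetric g u futureHalf z (rotGen z) (rotGen z)) := by
  -- The local constants are merged over a finite cover of the target by taking maxima.
  have key := (isCompact_univ (X := M)).induction_on
    (p := fun S => ∃ C ≥ 0, ∀ p ∈ S, ∀ z : SpaceTime, u z = p → 0 < z.1 → z.2 ≠ 0 → ∀ a,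
      |dirDeriv a (fun w => pullbackMetric g u futureHalf w (rotGen w) (rotGen w)) z| ≤
        C * √(pullbackMetric g u futureHalf z a a) *
          √(pullbackMetric g u futureHalf z (rotGen z) (rotGen z)))
    ⟨0, le_rfl, by simp⟩ ?_ ?_ ?_
  · obtain ⟨C, hC, h⟩ := key
    exact ⟨C, hC, fun z => h (u z) (mem_univ _) z rfl⟩
  · rintro S T hST ⟨C, hC, h⟩
    exact ⟨C, hC, fun p hp => h p (hST hp)⟩
  · rintro S T ⟨C, hC, h⟩ ⟨C', hC', h'⟩
    refine ⟨max C C', le_max_of_le_left hC, ?_⟩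
    rintro p (hp | hp) z hzp hz hz2 a
    · refine (h p hp z hzp hz hz2 a).trans ?_
      gcongr
      exact le_max_left _ _
    · refine (h' p hp z hzp hz hz2 a).trans ?_
      gcongr
      exact le_max_right _ _
  · intro p _
    obtain ⟨C, hC, h⟩ := exists_dirDeriv_angular_le_nhds g hΦ hΦ0 hu hsym p
    exact ⟨_, nhdsWithin_le_nhds h, C, hC, fun q hq => hq⟩

end Killing

/-! ### Energy and momentum densities along a ray -/

section Radial

open Set Filter Topology

/-- The embedding `(t, r) ↦ (t, (r, 0))` of a half-plane into space-time. -/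
noncomputable def rayMap : ℝ × ℝ →L[ℝ] SpaceTime :=
  (ContinuousLinearMap.fst ℝ ℝ ℝ).smulRight timeDir +
    (ContinuousLinearMap.snd ℝ ℝ ℝ).smulRight (spaceDir 0)

theorem rayMap_apply (q : ℝ × ℝ) : rayMap q = q.1 • timeDir + q.2 • spaceDir 0 := rfl

theorem rayMap_fst (q : ℝ × ℝ) : (rayMap q).1 = q.1 := by
  simp [rayMap_apply, timeDir, spaceDir]

theorem rayMap_eq_polarPoint (q : ℝ × ℝ) : rayMap q = (q.1, polarPoint q.2 0) := by
  ext i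
  · simp [rayMap_apply, timeDir, spaceDir]
  · fin_cases i <;> simp [rayMap_apply, timeDir, spaceDir, polarPoint]

theorem rotGen_eq (w : SpaceTime) : rotGen w = (-w.2 1) • spaceDir 0 + w.2 0 • spaceDir 1 := by
  ext i
  · simp [rotGen, spaceDir]
  · fin_cases i <;> simp [rotGen, spaceDir]

theorem rayMap_snd_zero (q : ℝ × ℝ) : (rayMap q).2 0 = q.2 := by
  simp [rayMap_eq_polarPoint, polarPoint]

theorem rayMap_snd_one (q : ℝ × ℝ) : (rayMap q).2 1 = 0 := by
  simp [rayMap_eq_polarPoint, polarPoint]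

theorem rayMap_snd_ne_zero {q : ℝ × ℝ} (hq : q.2 ≠ 0) : (rayMap q).2 ≠ 0 := fun h => by
  have := rayMap_snd_zero q
  rw [h] at this
  exact hq this.symm

theorem rotGen_rayMap (q : ℝ × ℝ) : rotGen (rayMap q) = q.2 • spaceDir 1 := by
  rw [rotGen_eq, rayMap_snd_zero, rayMap_snd_one]
  simp

variable {n : ℕ} {M : Type*} [TopologicalSpace M] [ChartedSpace (Euc n) M]
  [IsManifold (𝓡 n) ∞ M] {u : SpaceTime → M} {g : SmoothMetric n M}

local notation "h[" z ", " a ", " b "]" => pullbackMetric g u futureHalf z a b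

theorem energyDensity_eq (g : SmoothMetric n M) (u : SpaceTime → M) (z : SpaceTime) :
    energyDensity g u z = pullbackMetric g u futureHalf z (spaceDir 0) (spaceDir 0) +
      pullbackMetric g u futureHalf z (spaceDir 1) (spaceDir 1) +
      pullbackMetric g u futureHalf z timeDir timeDir := by
  rw [energyDensity, Fin.sum_univ_two]
  rfl

/-- The energy density along the ray `x = (r, 0)`. -/
noncomputable def rayEnergy (g : SmoothMetric n M) (u : SpaceTime → M) (q : ℝ × ℝ) : ℝ :=
  1 / 2 * energyDensity g u (rayMap q)

/-- The radial momentum density along the ray `x = (r, 0)`. -/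
noncomputable def rayMomentum (g : SmoothMetric n M) (u : SpaceTime → M) (q : ℝ × ℝ) : ℝ :=
  pullbackMetric g u futureHalf (rayMap q) timeDir (spaceDir 0)

theorem contDiffOn_pullbackMetric_ray (g : SmoothMetric n M)
    (hu : ContMDiffOn 𝓘(ℝ, SpaceTime) (𝓡 n) ∞ u futureHalf) (a b : SpaceTime) :
    ContDiffOn ℝ ∞ (fun q => pullbackMetric g u futureHalf (rayMap q) a b) {q | 0 ≤ q.1} :=
  (contDiffOn_pullbackMetric g uniqueDiffOn_futureHalf hu a b).comp rayMap.contDiff.contDiffOn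
    fun q hq => show 0 ≤ (rayMap q).1 by rw [rayMap_fst]; exact hq

theorem contDiffOn_rayEnergy (g : SmoothMetric n M)
    (hu : ContMDiffOn 𝓘(ℝ, SpaceTime) (𝓡 n) ∞ u futureHalf) :
    ContDiffOn ℝ ∞ (rayEnergy g u) {q | 0 ≤ q.1} := by
  unfold rayEnergy
  simp only [energyDensity_eq]
  exact contDiffOn_const.mul (((contDiffOn_pullbackMetric_ray g hu _ _).add
    (contDiffOn_pullbackMetric_ray g hu _ _)).add (contDiffOn_pullbackMetric_ray g hu _ _))

theorem hasFDerivAt_pullbackMetric_ray (g : SmoothMetric n M)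
    (hu : ContMDiffOn 𝓘(ℝ, SpaceTime) (𝓡 n) ∞ u futureHalf) {q : ℝ × ℝ} (hq : 0 < q.1)
    (a b : SpaceTime) : HasFDerivAt (fun q => pullbackMetric g u futureHalf (rayMap q) a b)
      ((fderiv ℝ (fun w => pullbackMetric g u futureHalf w a b) (rayMap q)).comp rayMap) q := by
  have h := ((contDiffAt_pullbackMetric g hu (z := rayMap q) (by rwa [rayMap_fst])
    a b).differentiableAt (by simp)).hasFDerivAt
  exact h.comp q rayMap.hasFDerivAt

/-- On the ray, `e ± m` is half of `|∂_r u ± ∂_t u|²` plus half the squared length of the derivative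
along `spaceDir 1`. -/
theorem abs_rayMomentum_le (g : SmoothMetric n M) (u : SpaceTime → M) (q : ℝ × ℝ) :
    |rayMomentum g u q| ≤ rayEnergy g u q := by
  have h1 := pullbackMetric_self_nonneg g u futureHalf (rayMap q) (spaceDir 0 + timeDir)
  have h2 := pullbackMetric_self_nonneg g u futureHalf (rayMap q) (spaceDir 0 + (-1 : ℝ) • timeDir)
  have h3 := pullbackMetric_self_nonneg g u futureHalf (rayMap q) (spaceDir 1)
  simp only [pullbackMetric_add_left, pullbackMetric_add_right, pullbackMetric_smul_left,
    pullbackMetric_smul_right,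
    pullbackMetric_symm g u futureHalf (rayMap q) (spaceDir 0) timeDir] at h1 h2
  rw [rayMomentum, rayEnergy, energyDensity_eq, abs_le]
  constructor <;> linarith

theorem rayEnergy_nonneg (g : SmoothMetric n M) (u : SpaceTime → M) (q : ℝ × ℝ) :
    0 ≤ rayEnergy g u q := (abs_nonneg _).trans (abs_rayMomentum_le g u q)

theorem pullbackMetric_rot_point {Φ : ℝ → Diffeomorph (𝓡 n) (𝓡 n) M M ∞}
    (hu : ContMDiffOn 𝓘(ℝ, SpaceTime) (𝓡 n) ∞ u futureHalf)
    (hiso : ∀ s, IsRiemannianIsometry g (Φ s)) (hΦ : IsRotationEquivariant u Φ)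
    {z : SpaceTime} (hz : z ∈ futureHalf) (hz2 : z.2 ≠ 0) (s : ℝ) (a b : SpaceTime) :
    h[rot s z, a, b] = h[z, rot (-s) a, rot (-s) b] := by
  have h := pullbackMetric_rot hu hiso hΦ hz hz2 s (rot (-s) a) (rot (-s) b)
  have e : ∀ a, rot s (rot (-s) a) = a := fun a => by simpa using rot_neg_rot (-s) a
  rwa [e, e] at h

/-- The derivative at `s = 0` of `pullbackMetric_rot_point`: on the ray the rotation moves in the
direction `q.2 • spaceDir 1`, while the rotated frame contributes terms without derivatives. This
eliminates the transversal derivatives from the divergence of the stress-energy tensor. -/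
theorem dirDeriv_angular_ray {Φ : ℝ → Diffeomorph (𝓡 n) (𝓡 n) M M ∞}
    (hu : ContMDiffOn 𝓘(ℝ, SpaceTime) (𝓡 n) ∞ u futureHalf)
    (hiso : ∀ s, IsRiemannianIsometry g (Φ s)) (hΦ : IsRotationEquivariant u Φ)
    {q : ℝ × ℝ} (hq : 0 < q.1) (hq2 : q.2 ≠ 0) :
    q.2 * dirDeriv (spaceDir 1) (fun w => h[w, spaceDir 1, timeDir]) (rayMap q) =
        h[rayMap q, spaceDir 0, timeDir] ∧
      q.2 * dirDeriv (spaceDir 1) (fun w => h[w, spaceDir 1, spaceDir 0]) (rayMap q) =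
        h[rayMap q, spaceDir 0, spaceDir 0] - h[rayMap q, spaceDir 1, spaceDir 1] := by
  set z := rayMap q with hz
  have hz1 : 0 < z.1 := by rwa [hz, rayMap_fst]
  have hr0 : rot 0 z = z := by
    ext i
    · simp [rot_apply]
    · fin_cases i <;> simp [rot_apply]
  have hd : ∀ a b, HasDerivAt (fun s => h[z, rot (-s) a, rot (-s) b])
      (q.2 * dirDeriv (spaceDir 1) (fun w => h[w, a, b]) z) 0 := by
    intro a b
    have h1 := ((contDiffAt_pullbackMetric g hu hz1 a b).differentiableAt (by simp)).hasFDerivAt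
    rw [← hr0] at h1
    have h2 := h1.comp_hasDerivAt 0 (hasDerivAt_rot z)
    rw [hr0, hz, rotGen_rayMap, map_smul, smul_eq_mul] at h2
    refine h2.congr_of_eventuallyEq (Eventually.of_forall fun s => ?_)
    exact (pullbackMetric_rot_point hu hiso hΦ (show (0 : ℝ) ≤ z.1 from hz1.le)
      (rayMap_snd_ne_zero hq2) s a b).symm
  have hs := Real.hasDerivAt_sin 0
  have hc := Real.hasDerivAt_cos 0
  constructor
  · refine (hd (spaceDir 1) timeDir).unique ?_
    simp only [rot_spaceDir_one, rot_timeDir, pullbackMetric_add_left, pullbackMetric_smul_left,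
      Real.sin_neg, Real.cos_neg, neg_neg]
    simpa using! (hs.mul_const h[z, spaceDir 0, timeDir]).add
      (hc.mul_const h[z, spaceDir 1, timeDir])
  · refine (hd (spaceDir 1) (spaceDir 0)).unique ?_
    simp only [rot_spaceDir_one, rot_spaceDir_zero, pullbackMetric_add_left,
      pullbackMetric_smul_left, pullbackMetric_add_right, pullbackMetric_smul_right,
      Real.sin_neg, Real.cos_neg, neg_neg]
    have h1 := (hs.mul ((hc.mul_const h[z, spaceDir 0, spaceDir 0]).add
        (hs.neg.mul_const h[z, spaceDir 0, spaceDir 1]))).add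
      (hc.mul ((hc.mul_const h[z, spaceDir 1, spaceDir 0]).add
        (hs.neg.mul_const h[z, spaceDir 1, spaceDir 1])))
    convert! h1 using 1
    · funext s
      simp only [Pi.add_apply, Pi.mul_apply, Pi.neg_apply]
      ring
    · simp only [Pi.add_apply, Pi.neg_apply, Real.sin_zero, Real.cos_zero]
      ring

/-- Moving along `spaceDir 0` stays on the ray, where `rotGen` is `r • spaceDir 1`; the angular
length is therefore `r²` times the component along `spaceDir 1`. -/
theorem dirDeriv_angular_length_ray
    (hu : ContMDiffOn 𝓘(ℝ, SpaceTime) (𝓡 n) ∞ u futureHalf) {q : ℝ × ℝ} (hq : 0 < q.1) :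
    dirDeriv (spaceDir 0) (fun w => h[w, rotGen w, rotGen w]) (rayMap q) =
      2 * q.2 * h[rayMap q, spaceDir 1, spaceDir 1] +
        q.2 ^ 2 * dirDeriv (spaceDir 0) (fun w => h[w, spaceDir 1, spaceDir 1]) (rayMap q) := by
  set z := rayMap q with hz
  have hz1 : 0 < z.1 := by rwa [hz, rayMap_fst]
  have hcd : ∀ a b, DifferentiableAt ℝ (fun w => h[w, a, b]) z := fun a b =>
    (contDiffAt_pullbackMetric g hu hz1 a b).differentiableAt (by simp)
  have hcoord : ∀ i : Fin 2, DifferentiableAt ℝ (fun w : SpaceTime => w.2 i) z := fun i =>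
    ((EuclideanSpace.proj (𝕜 := ℝ) i).comp (ContinuousLinearMap.snd ℝ ℝ (Euc 2))).differentiableAt
  have hW : DifferentiableAt ℝ (fun w => h[w, rotGen w, rotGen w]) z := by
    simp only [rotGen_eq, pullbackMetric_add_left,
      pullbackMetric_smul_left, pullbackMetric_add_right, pullbackMetric_smul_right]
    have h0 := hcoord 0
    have h1 := hcoord 1
    exact (h1.neg.mul ((h1.neg.mul (hcd _ _)).add (h0.mul (hcd _ _)))).add
      (h0.mul ((h1.neg.mul (hcd _ _)).add (h0.mul (hcd _ _))))
  refine (hasDerivAt_dirDeriv hW (spaceDir 0)).unique ?_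
  have hline : ∀ s : ℝ, z + s • spaceDir 0 = rayMap (q.1, q.2 + s) := by
    intro s
    simp only [hz, rayMap_apply, add_smul, add_assoc]
  have h1 := hasDerivAt_dirDeriv (hcd (spaceDir 1) (spaceDir 1)) (spaceDir 0)
  have h2 := (((hasDerivAt_id (0 : ℝ)).const_add q.2).pow 2).mul h1
  convert! h2 using 1
  · funext s
    simp only [Pi.mul_apply, Pi.pow_apply, id]
    rw [hline, rotGen_rayMap, pullbackMetric_smul_left, pullbackMetric_smul_right]
    ring
  · simp

section Identities

variable {Φ : ℝ → Diffeomorph (𝓡 n) (𝓡 n) M M ∞}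

theorem fderiv_rayEnergy (hu : ContMDiffOn 𝓘(ℝ, SpaceTime) (𝓡 n) ∞ u futureHalf)
    {q : ℝ × ℝ} (hq : 0 < q.1) (v : ℝ × ℝ) :
    fderiv ℝ (rayEnergy g u) q v =
      1 / 2 * (dirDeriv (rayMap v) (fun w => h[w, spaceDir 0, spaceDir 0]) (rayMap q) +
        dirDeriv (rayMap v) (fun w => h[w, spaceDir 1, spaceDir 1]) (rayMap q) +
        dirDeriv (rayMap v) (fun w => h[w, timeDir, timeDir]) (rayMap q)) := by
  have h1 := fun a => hasFDerivAt_pullbackMetric_ray g hu hq a a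
  have h2 : HasFDerivAt (rayEnergy g u) _ q :=
    ((((h1 (spaceDir 0)).add (h1 (spaceDir 1))).add (h1 timeDir)).const_mul (1 / 2)).congr_of_eventuallyEq
      (Eventually.of_forall fun p => by rw [rayEnergy, energyDensity_eq]; rfl)
  rw [h2.fderiv]
  rfl

theorem fderiv_rayMomentum (hu : ContMDiffOn 𝓘(ℝ, SpaceTime) (𝓡 n) ∞ u futureHalf)
    {q : ℝ × ℝ} (hq : 0 < q.1) (v : ℝ × ℝ) :
    fderiv ℝ (rayMomentum g u) q v =
      dirDeriv (rayMap v) (fun w => h[w, timeDir, spaceDir 0]) (rayMap q) := by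
  have h2 : HasFDerivAt (rayMomentum g u) _ q := hasFDerivAt_pullbackMetric_ray g hu hq _ _
  rw [h2.fderiv]
  rfl

theorem rayMap_time : rayMap (1, 0) = timeDir := by simp [rayMap_apply]

theorem rayMap_radial : rayMap (0, 1) = spaceDir 0 := by simp [rayMap_apply]

/-- Conservation of energy: `∂_t (r e) = ∂_r (r m)`. -/
theorem ray_energy_conservation (hwave : IsGlobalWaveMap g u)
    (hiso : ∀ s, IsRiemannianIsometry g (Φ s)) (hΦ : IsRotationEquivariant u Φ)
    {t r : ℝ} (ht : 0 < t) (hr : 0 < r) :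
    r * fderiv ℝ (rayEnergy g u) (t, r) (1, 0) =
      rayMomentum g u (t, r) + r * fderiv ℝ (rayMomentum g u) (t, r) (0, 1) := by
  have hu := hwave.smooth
  have hst := hwave.stress_energy (z := rayMap (t, r)) (by rwa [rayMap_fst]) 0
  obtain ⟨ha, -⟩ := dirDeriv_angular_ray hu hiso hΦ (q := (t, r)) ht hr.ne'
  rw [fderiv_rayEnergy hu ht, fderiv_rayMomentum hu ht, rayMap_time, rayMap_radial, rayMomentum]
  simp only [Fin.sum_univ_three, coordDir, minkowskiSign, Matrix.cons_val_zero,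
    Matrix.cons_val_one, Matrix.cons_val_two, Matrix.head_cons, Matrix.tail_cons] at hst
  simp only [pullbackMetric_symm g u futureHalf _ timeDir (spaceDir 0)]
  simp only at ha
  linear_combination ha - r * hst

/-- The defect `∂_t (r m) - ∂_r (r e)` of the conservation of the radial momentum is controlled
by `√(e² - m²)`. -/
theorem ray_momentum_defect_le (hwave : IsGlobalWaveMap g u)
    (hiso : ∀ s, IsRiemannianIsometry g (Φ s)) (hΦ : IsRotationEquivariant u Φ) {C : ℝ}
    (hC : 0 ≤ C) (hang : ∀ z : SpaceTime, 0 < z.1 → z.2 ≠ 0 → ∀ a,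
      |dirDeriv a (fun w => h[w, rotGen w, rotGen w]) z| ≤
        C * √(h[z, a, a]) * √(h[z, rotGen z, rotGen z]))
    {t r : ℝ} (ht : 0 < t) (hr : 0 < r) :
    |r * fderiv ℝ (rayMomentum g u) (t, r) (1, 0) -
        (rayEnergy g u (t, r) + r * fderiv ℝ (rayEnergy g u) (t, r) (0, 1))| ≤
      (2 + 2 * C) * √((rayEnergy g u (t, r) + rayMomentum g u (t, r)) *
        (rayEnergy g u (t, r) - rayMomentum g u (t, r))) := by
  have hu := hwave.smooth
  have hst := hwave.stress_energy (z := rayMap (t, r)) (by rwa [rayMap_fst]) 1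
  obtain ⟨-, hb⟩ := dirDeriv_angular_ray hu hiso hΦ (q := (t, r)) ht hr.ne'
  have hW := hang (rayMap (t, r)) (by rwa [rayMap_fst]) (rayMap_snd_ne_zero hr.ne') (spaceDir 0)
  rw [dirDeriv_angular_length_ray hu ht, rotGen_rayMap, pullbackMetric_smul_left,
    pullbackMetric_smul_right] at hW
  rw [fderiv_rayEnergy hu ht, fderiv_rayMomentum hu ht, rayMap_time, rayMap_radial]
  simp only [Fin.sum_univ_three, coordDir, minkowskiSign, Matrix.cons_val_zero,
    Matrix.cons_val_one, Matrix.cons_val_two, Matrix.head_cons, Matrix.tail_cons] at hst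
  simp only at hb hW
  have hcs := pullbackMetric_sq_le g u futureHalf (rayMap (t, r))
    (spaceDir 0 + (-1 : ℝ) • timeDir) (spaceDir 0 + timeDir)
  have hp1 := pullbackMetric_self_nonneg g u futureHalf (rayMap (t, r)) (spaceDir 0 + timeDir)
  have hp2 := pullbackMetric_self_nonneg g u futureHalf (rayMap (t, r))
    (spaceDir 0 + (-1 : ℝ) • timeDir)
  have h0 := pullbackMetric_self_nonneg g u futureHalf (rayMap (t, r)) timeDir
  have h1 := pullbackMetric_self_nonneg g u futureHalf (rayMap (t, r)) (spaceDir 0)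
  have h2 := pullbackMetric_self_nonneg g u futureHalf (rayMap (t, r)) (spaceDir 1)
  simp only [pullbackMetric_add_left, pullbackMetric_add_right, pullbackMetric_smul_left,
    pullbackMetric_smul_right,
    pullbackMetric_symm g u futureHalf (rayMap (t, r)) (spaceDir 0) timeDir] at hcs hp1 hp2
  rw [rayEnergy, energyDensity_eq, rayMomentum]
  set P00 := h[rayMap (t, r), timeDir, timeDir]
  set P11 := h[rayMap (t, r), spaceDir 0, spaceDir 0]
  set P22 := h[rayMap (t, r), spaceDir 1, spaceDir 1]
  set P01 := h[rayMap (t, r), timeDir, spaceDir 0]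
  set D := dirDeriv (spaceDir 0) (fun w => h[w, spaceDir 1, spaceDir 1]) (rayMap (t, r))
  set D0 := dirDeriv timeDir (fun w => h[w, timeDir, spaceDir 0]) (rayMap (t, r))
  -- With `α` and `β` the halved squared lengths of `∂_r u ± ∂_t u`, `P = (α + P22 / 2) (β + P22 /
  -- 2)`. Each part of the defect is compared with one term of this product.
  set P := (1 / 2 * (P11 + P22 + P00) + P01) * (1 / 2 * (P11 + P22 + P00) - P01) with hP
  set α := 1 / 2 * (P00 + P11) + P01 with hα
  set β := 1 / 2 * (P00 + P11) - P01 with hβ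
  have hα0 : 0 ≤ α := by linarith
  have hβ0 : 0 ≤ β := by linarith
  have hPeq : P = α * β + (1 / 2 * P22) * (α + β) + (1 / 2 * P22) ^ 2 := by
    rw [hP, hα, hβ]
    ring
  have hαβ := mul_nonneg hα0 hβ0
  have hcαβ : 0 ≤ (1 / 2 * P22) * (α + β) := by positivity
  have b1 : |1 / 2 * (P11 - P00)| ≤ √P := by
    refine Real.abs_le_sqrt ?_
    rw [hPeq]
    -- Cauchy–Schwarz `hcs` for the null derivatives, since `⟨∂_r u - ∂_t u, ∂_r u + ∂_t u⟩ = P11 -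
    -- P00`.
    have : (1 / 2 * (P11 - P00)) ^ 2 ≤ α * β := by
      rw [hα, hβ]
      nlinarith
    nlinarith [sq_nonneg (1 / 2 * P22)]
  have b2 : 1 / 2 * P22 ≤ √P := Real.le_sqrt_of_sq_le (by rw [hPeq]; linarith)
  have b3 : √P11 * √P22 ≤ 2 * √P := by
    rw [← Real.sqrt_mul h1, ← Real.sqrt_sq (by norm_num : (0 : ℝ) ≤ 2), ← Real.sqrt_mul (by norm_num)]
    refine Real.sqrt_le_sqrt ?_
    have : P11 ≤ α + β := by rw [hα, hβ]; linarith
    have : 1 / 2 * P22 * P11 ≤ 1 / 2 * P22 * (α + β) :=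
      mul_le_mul_of_nonneg_left this (by positivity)
    nlinarith [sq_nonneg (1 / 2 * P22)]
  have b4 : |2 * P22 + r * D| ≤ C * (√P11 * √P22) := by
    have e1 : r * (r * P22) = r ^ 2 * P22 := by ring
    rw [e1, Real.sqrt_mul (sq_nonneg r), Real.sqrt_sq hr.le] at hW
    have e2 : 2 * r * P22 + r ^ 2 * D = r * (2 * P22 + r * D) := by ring
    rw [e2, abs_mul, abs_of_pos hr] at hW
    refine le_of_mul_le_mul_left (hW.trans (le_of_eq ?_)) hr
    ring
  -- The radial component of the divergence, with the transversal derivative replaced through `hb`.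
  -- The bounds `b1`, `b2` and `b4` with `b3` for the three terms add up to `1 + 1 + 2 C`.
  have hval : r * D0 - (1 / 2 * (P11 + P22 + P00) + r * (1 / 2 *
      (dirDeriv (spaceDir 0) (fun w => h[w, spaceDir 0, spaceDir 0]) (rayMap (t, r)) + D +
        dirDeriv (spaceDir 0) (fun w => h[w, timeDir, timeDir]) (rayMap (t, r))))) =
      1 / 2 * (P11 - P00) + 1 / 2 * P22 - (2 * P22 + r * D) := by
    linear_combination hb - r * hst
  rw [hval]
  have b5 : C * (√P11 * √P22) ≤ C * (2 * √P) := mul_le_mul_of_nonneg_left b3 hC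
  have b6 := abs_sub (1 / 2 * (P11 - P00) + 1 / 2 * P22) (2 * P22 + r * D)
  have b7 := abs_add_le (1 / 2 * (P11 - P00)) (1 / 2 * P22)
  rw [abs_of_nonneg (by positivity : 0 ≤ 1 / 2 * P22)] at b7
  linarith

end Identities

end Radial

/-! ### Polar integration and conclusion -/

section Final

open Set Filter Topology MeasureTheory

/-- Integration of a radial function over an annulus in the plane. -/
theorem lintegral_annulus {F : ℝ → ℝ} (hF : Continuous F) (hF0 : ∀ r, 0 ≤ F r) {a b : ℝ}
    (ha : 0 ≤ a) (hab : a ≤ b) :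
    ∫⁻ x in {x : Euc 2 | a < ‖x‖ ∧ ‖x‖ < b}, ENNReal.ofReal (F ‖x‖) =
      ENNReal.ofReal (2 * volume.real (Metric.ball (0 : Euc 2) 1) * ∫ s in a..b, s * F s) := by
  have hmeas : MeasurableSet {x : Euc 2 | a < ‖x‖ ∧ ‖x‖ < b} :=
    (measurableSet_lt measurable_const measurable_norm).inter
      (measurableSet_lt measurable_norm measurable_const)
  have hint : IntegrableOn (fun x : Euc 2 => F ‖x‖) {x : Euc 2 | a < ‖x‖ ∧ ‖x‖ < b} := by
    refine ((hF.comp continuous_norm).continuousOn.integrableOn_compact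
      (isCompact_closedBall (0 : Euc 2) b)).mono_set fun x hx => ?_
    simpa using hx.2.le
  rw [← ofReal_integral_eq_lintegral_ofReal hint (ae_of_all _ fun x => hF0 _)]
  congr 1
  rw [← integral_indicator hmeas]
  have h1 : ({x : Euc 2 | a < ‖x‖ ∧ ‖x‖ < b}.indicator fun x => F ‖x‖) =
      fun x : Euc 2 => (Ioo a b).indicator F ‖x‖ := by
    funext x
    simp [indicator]
  rw [h1, integral_fun_norm_addHaar volume ((Ioo a b).indicator F)]
  simp only [finrank_euclideanSpace, Fintype.card_fin, Nat.add_one_sub_one, pow_one, smul_eq_mul,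
    nsmul_eq_mul, Nat.cast_ofNat]
  rw [mul_assoc]
  congr 2
  have h2 : (fun y => y * (Ioo a b).indicator F y) = (Ioo a b).indicator fun y => y * F y := by
    funext y
    by_cases hy : y ∈ Ioo a b <;> simp [hy]
  rw [h2, integral_indicator measurableSet_Ioo, Measure.restrict_restrict measurableSet_Ioo,
    intervalIntegral.integral_of_le hab, integral_Ioc_eq_integral_Ioo]
  congr 2
  exact inter_eq_left.2 fun y hy => ha.trans_lt hy.1

variable {n : ℕ} {M : Type*} [TopologicalSpace M] [ChartedSpace (Euc n) M]
  [IsManifold (𝓡 n) ∞ M] {u : SpaceTime → M} {g : SmoothMetric n M}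
  {Φ : ℝ → Diffeomorph (𝓡 n) (𝓡 n) M M ∞}

theorem energyDensity_rot (hu : ContMDiffOn 𝓘(ℝ, SpaceTime) (𝓡 n) ∞ u futureHalf)
    (hiso : ∀ s, IsRiemannianIsometry g (Φ s)) (hΦ : IsRotationEquivariant u Φ)
    {z : SpaceTime} (hz : z ∈ futureHalf) (hz2 : z.2 ≠ 0) (s : ℝ) :
    energyDensity g u (rot s z) = energyDensity g u z := by
  simp only [energyDensity_eq, pullbackMetric_rot_point hu hiso hΦ hz hz2, rot_spaceDir_zero,
    rot_spaceDir_one, rot_timeDir, pullbackMetric_add_left, pullbackMetric_add_right,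
    pullbackMetric_smul_left, pullbackMetric_smul_right]
  linear_combination (pullbackMetric g u futureHalf z (spaceDir 0) (spaceDir 0) +
    pullbackMetric g u futureHalf z (spaceDir 1) (spaceDir 1)) * Real.sin_sq_add_cos_sq (-s)

theorem energyDensity_eq_rayEnergy (hu : ContMDiffOn 𝓘(ℝ, SpaceTime) (𝓡 n) ∞ u futureHalf)
    (hiso : ∀ s, IsRiemannianIsometry g (Φ s)) (hΦ : IsRotationEquivariant u Φ)
    {t : ℝ} (ht : 0 ≤ t) {x : Euc 2} (hx : x ≠ 0) :
    energyDensity g u (t, x) = 2 * rayEnergy g u (t, ‖x‖) := by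
  obtain ⟨θ, hθ⟩ := exists_eq_polarPoint x
  have hn : ‖x‖ ≠ 0 := norm_ne_zero_iff.2 hx
  have h := energyDensity_rot hu hiso hΦ (z := rayMap (t, ‖x‖))
    (show 0 ≤ (rayMap (t, ‖x‖)).1 by rwa [rayMap_fst]) (rayMap_snd_ne_zero hn) θ
  rw [rayMap_eq_polarPoint, rot_polarPoint, zero_add] at h
  simp only at h
  rw [← hθ] at h
  rw [h, rayEnergy, rayMap_eq_polarPoint]
  ring

theorem continuous_rayEnergy (hu : ContMDiffOn 𝓘(ℝ, SpaceTime) (𝓡 n) ∞ u futureHalf)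
    {t : ℝ} (ht : 0 ≤ t) : Continuous fun r => rayEnergy g u (t, r) :=
  (contDiffOn_rayEnergy g hu).continuousOn.comp_continuous (f := fun r => (t, r)) (by fun_prop)
    fun _ => ht

/-- The factor `4` is `2` from polar integration times `2` from the `1 / 2` in `rayEnergy`. The
annulus omits the origin even for `a = 0`, so equivariance is available on all of it. -/
theorem energyOn_annulus (hu : ContMDiffOn 𝓘(ℝ, SpaceTime) (𝓡 n) ∞ u futureHalf)
    (hiso : ∀ s, IsRiemannianIsometry g (Φ s)) (hΦ : IsRotationEquivariant u Φ)
    {t a b : ℝ} (ht : 0 ≤ t) (ha : 0 ≤ a) (hab : a ≤ b) :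
    energyOn g u t {x : Euc 2 | a < ‖x‖ ∧ ‖x‖ < b} =
      ENNReal.ofReal (4 * volume.real (Metric.ball (0 : Euc 2) 1) *
        ∫ s in a..b, s * rayEnergy g u (t, s)) := by
  have hmeas : MeasurableSet {x : Euc 2 | a < ‖x‖ ∧ ‖x‖ < b} :=
    (measurableSet_lt measurable_const measurable_norm).inter
      (measurableSet_lt measurable_norm measurable_const)
  rw [energyOn, setLIntegral_congr_fun (g := fun x => ENNReal.ofReal (2 * rayEnergy g u (t, ‖x‖)))
    hmeas fun x hx => by
      rw [energyDensity_eq_rayEnergy hu hiso hΦ ht (norm_pos_iff.1 (ha.trans_lt hx.1))]]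
  rw [lintegral_annulus (F := fun r => 2 * rayEnergy g u (t, r))
    (continuous_const.mul (continuous_rayEnergy hu ht))
    (fun r => mul_nonneg zero_le_two (rayEnergy_nonneg g u _)) ha hab]
  congr 1
  have : (fun s => s * (2 * rayEnergy g u (t, s))) = fun s => 2 * (s * rayEnergy g u (t, s)) := by
    funext s
    ring
  rw [this, intervalIntegral.integral_const_mul]
  ring

end Final

theorem propositionp {n : ℕ} {M : Type*} [TopologicalSpace M] [T2Space M] [CompactSpace M]
    [ChartedSpace (Euc n) M] [IsManifold (𝓡 n) ∞ M] (g : SmoothMetric n M)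
    (u : SpaceTime → M) (hwave : IsGlobalWaveMap g u) (henergy : FiniteEnergy g u)
    (hquasi : IsQuasiEquivariant g u) (lam : ℝ) (hlam₀ : 0 < lam) (hlam₁ : lam < 1) :
    Filter.Tendsto
      (fun p : ℝ × ℝ => energyOn g u p.1 {x : Euc 2 | lam * p.1 < ‖x‖ ∧ ‖x‖ < p.1 - p.2})
      ((Filter.atTop ×ˢ Filter.atTop) ⊓
        Filter.principal {p : ℝ × ℝ | p.2 ≤ (1 - lam) * p.1})
      (nhds 0) := by
  obtain ⟨Φ, hΦs, hiso, -, hΦ0, hpolar⟩ := hquasi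
  have hu := hwave.smooth
  have hΦ : IsRotationEquivariant u Φ := isRotationEquivariant_of_polar hpolar
  obtain ⟨C, hC, hang⟩ := exists_dirDeriv_angular_le g hΦs hΦ0 hu hΦ
  set κ := 4 * MeasureTheory.volume.real (Metric.ball (0 : Euc 2) 1) with hκ
  have hκpos : 0 < κ := by
    have : 0 < MeasureTheory.volume.real (Metric.ball (0 : Euc 2) 1) :=
      ENNReal.toReal_pos (Metric.measure_ball_pos _ _ one_pos).ne' MeasureTheory.measure_ball_lt_top.ne
    positivity
  have hpos_sub : {q : ℝ × ℝ | 0 < q.1} ⊆ {q : ℝ × ℝ | 0 ≤ q.1} := fun q (hq : 0 < q.1) => hq.le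
  -- The radial integral is the energy of a punctured disc divided by `κ`, so the total initial
  -- energy bounds it for every `R`.
  have hE : ∀ R, 0 ≤ R → ∫ s in (0 : ℝ)..R, s * rayEnergy g u (0, s) ≤
      (energyOn g u 0 Set.univ).toReal / κ := by
    intro R hR
    rw [le_div_iff₀ hκpos, mul_comm]
    have h1 := energyOn_annulus (g := g) hu hiso hΦ le_rfl le_rfl hR
    have h2 : energyOn g u 0 {x : Euc 2 | 0 < ‖x‖ ∧ ‖x‖ < R} ≤ energyOn g u 0 Set.univ :=
      MeasureTheory.lintegral_mono_set (Set.subset_univ _)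
    rw [h1] at h2
    exact (ENNReal.ofReal_le_iff_le_toReal henergy.ne).1 h2
  have hvan := fun {ε : ℝ} (hε : 0 < ε) => radial_energy_vanishing (e := rayEnergy g u)
    (m := rayMomentum g u) (C := 2 + 2 * C) (ε := ε) (by positivity) hlam₀ hlam₁
    (((contDiffOn_rayEnergy g hu).mono hpos_sub).of_le (by norm_cast))
    (((contDiffOn_pullbackMetric_ray g hu _ _).mono hpos_sub).of_le (by norm_cast))
    (contDiffOn_rayEnergy g hu).continuousOn (fun z _ => abs_rayMomentum_le g u z)
    (fun t r ht hr => ray_energy_conservation hwave hiso hΦ ht hr)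
    (fun t r ht hr => ray_momentum_defect_le hwave hiso hΦ hC hang ht hr) hE hε
  rw [ENNReal.tendsto_nhds_zero]
  intro ε hε
  obtain ⟨δ, hδ, hδε⟩ : ∃ δ : ℝ, 0 < δ ∧ ENNReal.ofReal δ ≤ ε := by
    obtain ⟨δ, -, h0, h1⟩ := ENNReal.lt_iff_exists_real_btwn.1 hε
    exact ⟨δ, ENNReal.ofReal_pos.1 h0, h1.le⟩
  obtain ⟨T₀, hT₀, A₀, hA₀, h⟩ := hvan (div_pos hδ hκpos)
  rw [Filter.eventually_inf_principal]
  filter_upwards [(Filter.eventually_ge_atTop T₀).prod_mk (Filter.eventually_ge_atTop A₀)]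
    with p hp hpA
  have hT : 0 < p.1 := hT₀.trans_le hp.1
  have hpA' : p.2 ≤ (1 - lam) * p.1 := hpA
  rw [energyOn_annulus hu hiso hΦ hT.le (by positivity) (by linarith)]
  refine (ENNReal.ofReal_le_ofReal ?_).trans hδε
  have h1 := h p.1 hp.1 p.2 hp.2 hpA'
  rw [le_div_iff₀ hκpos] at h1
  rw [← hκ]
  linarith
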